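/- Let $X$ be a complex Banach space and $L(X)$ the space of bounded linear operators on $X$ with the operator norm. A *hyperoperator* on $\mathbb R$ is a continuous linear map $A:\mathcal D(\mathbb R)\to L(X)$, where $\mathcal D(\mathbb R)=C_c^\infty(\mathbb R;\mathbb C)$ carries its usual topology, such that $A(\phi\psi)=A(\phi)A(\psi)$ for all $\phi,\psi$, the union $\bigcup_{\phi}\operatorname{Im}A(\phi)$ is dense in $X$, and $\bigcap_{\phi}\operatorname{Ker}A(\phi)=\{0\}$. A *Helffer–Sjöstrand (HS) operator* is a closed densely defined operator $a$ on $X$ such that $z-a$ has a bounded inverse for every $z\in\mathbb C\setminus\mathbb R$ and such that for each compact $K\subset\mathbb C$ there are $C_K,N_K$ with $\|(z-a)^{-1}\|\le C_K|\operatorname{Im}z|^{-N_K}$ for $z\in K\setminus\mathbb R$. Its functional calculus is $$[a](\phi)=\frac1{2\pi i}\int_{\mathbb C}(z-a)^{-1}\,dz\wedge\bar\partial\tilde\phi(z)=-\frac1\pi\int_{\mathbb C}\frac{\partial\tilde\phi}{\partial\bar z}(z)\,(z-a)^{-1}\,dx\,dy,\qquad \phi\in\mathcal D(\mathbb R),$$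 where $\tilde\phi\in C_c^\infty(\mathbb C)$ is any almost holomorphic extension of $\phi$, i.e. $\tilde\phi=\phi$ on $\mathbb R$ and $\partial\tilde\phi/\partial\bar z=O(|\operatorname{Im}z|^N)$ for every $N$. Let $\mathcal G(\mathbb R)$ be the algebra of smooth functions on the extended real line $\widehat{\mathbb R}=\mathbb R\cup\{\infty\}$ that extend holomorphically to a complex neighbourhood of $\infty$ in $\widehat{\mathbb C}$; it contains $\mathcal D(\mathbb R)$ (extension by $0$ at $\infty$). A sequence $f_j$ converges to $f$ in $\mathcal G(\mathbb R)$ if all derivatives converge uniformly on $\widehat{\mathbb R}$ (in local coordinates), all $f_j$ and $f$ are holomorphic in one fixed complex neighbourhood of $\infty$, and $f_j\to f$ uniformly on compact subsets of this neighbourhood. A map $B:\mathcal G(\mathbb R)\to L(X)$ is continuous if $f_j\to f$ in $\mathcal G(\mathbb R)$ implies $B(f_j)\to B(f)$ in operator norm. **Theorem 6.3.** Let $A$ be a hyperoperator on $\mathbb R$. Then there is an HS operator $a$ on $X$ with $A=[a]$ if and only if $A:\mathcal D(\mathbb R)\to L(X)$ has an extension to a continuous linear multiplicative map $\mathcal G(\mathbb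 R)\to L(X)$. -/

import Mathlib

open MeasureTheory Filter Topology
open scoped Distributions ContDiff

noncomputable section

namespace SmoothCalculus

/-! ### Test functions and hyperoperators -/

/-- The space `𝒟(ℝ)` of complex-valued smooth compactly supported functions on `ℝ`, with its
canonical LF topology. -/
abbrev TestFn : Type := 𝓓((⊤ : TopologicalSpace.Opens ℝ), ℂ)

/-- The pointwise product of two test functions. -/
def TestFn.mul (φ ψ : TestFn) : TestFn where
  toFun := fun x => φ x * ψ x
  contDiff' := φ.contDiff.mul ψ.contDiff
  hasCompactSupport' := φ.hasCompactSupport.mul_right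
  tsupport_subset' := fun _ _ => trivial

variable {X : Type*} [NormedAddCommGroup X] [NormedSpace ℂ X]

/-- A hyperoperator on `ℝ`: a continuous linear map `A : 𝒟(ℝ) → L(X)`, where `L(X)` has the operator
norm, which is multiplicative, such that the union of the ranges of the `A φ` is dense and the
intersection of their kernels is `0`. -/
structure IsHyperoperator (A : TestFn →L[ℂ] (X →L[ℂ] X)) : Prop where
  map_mul : ∀ φ ψ : TestFn, A (φ.mul ψ) = (A φ).comp (A ψ)
  dense_range : Dense (⋃ φ : TestFn, Set.range (A φ))
  ker_eq_zero : ∀ x : X, (∀ φ : TestFn, A φ x = 0) → x = 0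

/-! ### Closed operators, resolvents, Helffer-Sjöstrand operators -/

/-- `R` is a bounded two-sided inverse of `z - a : Dom a → X`. -/
def IsResolventAt (a : X →ₗ.[ℂ] X) (z : ℂ) (R : X →L[ℂ] X) : Prop :=
  (∀ x : a.domain, R (z • (x : X) - a x) = x) ∧
    ∀ y : X, ∃ x : a.domain, (x : X) = R y ∧ z • (x : X) - a x = y

/-- There is at most one resolvent at a given point. -/
theorem IsResolventAt.unique {a : X →ₗ.[ℂ] X} {z : ℂ} {R S : X →L[ℂ] X}
    (hR : IsResolventAt a z R) (hS : IsResolventAt a z S) : R = S := by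
  ext y
  obtain ⟨x, hx, hxy⟩ := hS.2 y
  rw [← hx, ← hR.1 x, hxy]

/-- The finite part of the resolvent set of `a`. -/
def resolventPoints (a : X →ₗ.[ℂ] X) : Set ℂ := {z | ∃ R : X →L[ℂ] X, IsResolventAt a z R}

open Classical in
/-- The resolvent `(z - a)⁻¹` for `z` in the resolvent set (and `0` for other `z`). -/
def pmapResolvent (a : X →ₗ.[ℂ] X) (z : ℂ) : X →L[ℂ] X :=
  if h : ∃ R : X →L[ℂ] X, IsResolventAt a z R then h.choose else 0

theorem isResolventAt_pmapResolvent {a : X →ₗ.[ℂ] X} {z : ℂ} (h : z ∈ resolventPoints a) :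
    IsResolventAt a z (pmapResolvent a z) := by
  have h' : ∃ R : X →L[ℂ] X, IsResolventAt a z R := h
  rw [pmapResolvent, dif_pos h']
  exact h'.choose_spec

/-- A Helffer-Sjöstrand operator: a closed densely defined operator with real spectrum (the point
`∞` of the extended line may belong to the spectrum) whose resolvent satisfies, locally uniformly,
a bound by a power of `1 / |Im z|`. -/
structure IsHSOperator (a : X →ₗ.[ℂ] X) : Prop where
  dense_domain : Dense (a.domain : Set X)
  closed : a.IsClosed
  real_spectrum : ∀ z : ℂ, z ∉ resolventPoints a → z.im = 0
  resolvent_bound : ∀ K : Set ℂ, IsCompact K → ∃ (N : ℕ) (C : ℝ),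
    ∀ z ∈ K, z.im ≠ 0 → ‖pmapResolvent a z‖ ≤ C * (1 / |z.im|) ^ N

/-! ### The functional calculus of a Helffer-Sjöstrand operator -/

/-- The Cauchy-Riemann operator `∂f/∂z̄ = (∂f/∂x + i ∂f/∂y) / 2`. -/
def dbar (f : ℂ → ℂ) (z : ℂ) : ℂ :=
  (1 / 2 : ℂ) * (fderiv ℝ f z 1 + Complex.I * fderiv ℝ f z Complex.I)

/-- `F` is a smooth almost holomorphic extension of `φ` to `ℂ` with compact support:
`∂F/∂z̄ = O(|Im z|^N)` for every `N`. -/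
structure IsAlmostHolExtension (φ : TestFn) (F : ℂ → ℂ) : Prop where
  contDiff : ContDiff ℝ ∞ F
  hasCompactSupport : HasCompactSupport F
  extends_fn : ∀ x : ℝ, F x = φ x
  dbar_bound : ∀ N : ℕ, ∃ C : ℝ, ∀ z : ℂ, ‖dbar F z‖ ≤ C * |z.im| ^ N

/-- `A = [a]`: for every test function `φ` and every almost holomorphic extension `F` of `φ` with
compact support, `A φ = ∫ (2πi)⁻¹ (z - a)⁻¹ dz ∧ ∂̄F`, an absolutely convergent integral in `L(X)`.
Since `dz ∧ dz̄ = -2i dx ∧ dy`, the integral is `-π⁻¹ ∫ (∂F/∂z̄) (z - a)⁻¹ dx dy`. -/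
def IsHSCalculus (a : X →ₗ.[ℂ] X) (A : TestFn →L[ℂ] (X →L[ℂ] X)) : Prop :=
  ∀ (φ : TestFn) (F : ℂ → ℂ), IsAlmostHolExtension φ F →
    Integrable (fun z : ℂ => dbar F z • pmapResolvent a z) ∧
    A φ = (-(1 / Real.pi : ℂ)) • ∫ z : ℂ, dbar F z • pmapResolvent a z

/-! ### The algebra `𝒢(ℝ)` -/

/-- In the coordinate `w = 1 / z` at `∞`, the function `g` is holomorphic on the disc `|w| < r` and
agrees there with `f` on the extended real line. -/
structure IsHolNearInfty (f : OnePoint ℝ → ℂ) (r : ℝ) (g : ℂ → ℂ) : Prop where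
  differentiableOn : DifferentiableOn ℂ g (Metric.ball 0 r)
  at_zero : g 0 = f OnePoint.infty
  at_inv : ∀ t : ℝ, t ≠ 0 → |t| < r → g t = f ((t⁻¹ : ℝ) : OnePoint ℝ)

/-- The algebra `𝒢(ℝ)` of smooth functions on the extended real line that are holomorphic in a
complex neighbourhood of `∞`. -/
def G : Subalgebra ℂ (OnePoint ℝ → ℂ) where
  carrier := {f | ContDiff ℝ ∞ (fun x : ℝ => f (x : OnePoint ℝ)) ∧
    ∃ r > 0, ∃ g : ℂ → ℂ, IsHolNearInfty f r g}
  mul_mem' := by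
    rintro f₁ f₂ ⟨h₁, r₁, hr₁, g₁, k₁⟩ ⟨h₂, r₂, hr₂, g₂, k₂⟩
    refine ⟨h₁.mul h₂, min r₁ r₂, lt_min hr₁ hr₂, fun w => g₁ w * g₂ w, ?_, ?_, ?_⟩
    · exact (k₁.1.mono (Metric.ball_subset_ball (min_le_left _ _))).mul
        (k₂.1.mono (Metric.ball_subset_ball (min_le_right _ _)))
    · simp [k₁.2, k₂.2]
    · intro t ht htr
      simp [k₁.3 t ht (htr.trans_le (min_le_left _ _)), k₂.3 t ht (htr.trans_le (min_le_right _ _))]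
  add_mem' := by
    rintro f₁ f₂ ⟨h₁, r₁, hr₁, g₁, k₁⟩ ⟨h₂, r₂, hr₂, g₂, k₂⟩
    refine ⟨h₁.add h₂, min r₁ r₂, lt_min hr₁ hr₂, fun w => g₁ w + g₂ w, ?_, ?_, ?_⟩
    · exact (k₁.1.mono (Metric.ball_subset_ball (min_le_left _ _))).add
        (k₂.1.mono (Metric.ball_subset_ball (min_le_right _ _)))
    · simp [k₁.2, k₂.2]
    · intro t ht htr
      simp [k₁.3 t ht (htr.trans_le (min_le_left _ _)), k₂.3 t ht (htr.trans_le (min_le_right _ _))]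
  algebraMap_mem' := by
    intro c
    exact ⟨contDiff_const, 1, one_pos, fun _ => c, differentiableOn_const c, rfl, fun _ _ _ => rfl⟩

/-- A test function, extended by `0` to `∞`, belongs to `𝒢(ℝ)`. -/
def TestFn.toG (φ : TestFn) : G where
  val := fun p => p.elim 0 (fun x => φ x)
  property := by
    refine ⟨φ.contDiff, ?_⟩
    obtain ⟨R, hR⟩ := φ.hasCompactSupport.isCompact.isBounded.subset_closedBall 0
    refine ⟨1 / (|R| + 1), by positivity, fun _ => 0, differentiableOn_const 0, rfl, ?_⟩
    intro t ht htr
    symm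
    change φ t⁻¹ = 0
    by_contra hne
    have h1 : |t⁻¹| ≤ R := by
      simpa using hR (subset_tsupport _ (Function.mem_support.2 hne))
    have h2 : |R| + 1 < |t|⁻¹ := by
      rw [lt_inv_comm₀ (by positivity) (abs_pos.2 ht)]
      simpa using htr
    rw [abs_inv] at h1
    linarith [le_abs_self R]

/-- Convergence of a sequence in `𝒢(ℝ)`: all derivatives converge locally uniformly on `ℝ`, all
terms and the limit are holomorphic in a fixed disc around `∞` (in the coordinate `w = 1 / z`), and
they converge locally uniformly in this disc. (By Cauchy's estimates this contains the convergence
of all derivatives near the point `∞` of the extended line.) -/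
def TendstoG (u : ℕ → G) (f : G) : Prop :=
  (∀ k : ℕ, TendstoLocallyUniformly
    (fun j => iteratedDeriv k (fun x : ℝ => (u j : OnePoint ℝ → ℂ) (x : OnePoint ℝ)))
    (iteratedDeriv k (fun x : ℝ => (f : OnePoint ℝ → ℂ) (x : OnePoint ℝ))) atTop) ∧
  ∃ r > 0, ∃ (gs : ℕ → ℂ → ℂ) (g : ℂ → ℂ),
    (∀ j, IsHolNearInfty (u j : OnePoint ℝ → ℂ) r (gs j)) ∧
    IsHolNearInfty (f : OnePoint ℝ → ℂ) r g ∧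
    TendstoLocallyUniformlyOn gs g atTop (Metric.ball 0 r)

/-- `B : 𝒢(ℝ) → L(X)` is continuous: convergence in `𝒢(ℝ)` implies convergence of the images in
operator norm. -/
def IsContinuousOnG (B : G → (X →L[ℂ] X)) : Prop :=
  ∀ (u : ℕ → G) (f : G), TendstoG u f → Tendsto (fun j => B (u j)) atTop (𝓝 (B f))

end SmoothCalculus

end

noncomputable section

namespace SmoothCalculus

/-! Both directions rest on one principle (`cauchyIntegral_comp`). Suppose operators `R z` satisfy
`R z ∘ A φ = A (φ / (z - ·))` off the real axis, and `Ψ` has limit `c` at infinity and a compactly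
supported `∂̄Ψ` vanishing to infinite order on `ℝ`. Then `(-π⁻¹ ∫ ∂̄Ψ(z) R z) ∘ A φ = A (φ (Ψ -
c))`: `A` may be moved outside the integral (`map_cauchyIntegral`), and the Cauchy-Pompeiu formula
(`integral_dbar_div`) evaluates the scalar integral. Since the ranges of the `A φ` are dense, an
operator is determined by its compositions with them (`IsHyperoperator.ext`).

From `a` to the extension: given `f ∈ 𝒢(ℝ)` with holomorphic extension `g(1/z)` near infinity, take
an almost holomorphic cutoff `Θ` of a test function `θ`, with `Θ = 1` on a large disc. Then `θ f` is
a test function, and `Ψ = (1 - Θ) g(1/z)` extends `(1 - θ) f` and tends to `f(∞)`. Put `B f = A (θ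
f) + f(∞) - π⁻¹ ∫ ∂̄Ψ(z) (z - a)⁻¹`. By the principle `B f ∘ A φ = A (f φ)`. This characterizes `B
f`, so all choices are immaterial and linearity and multiplicativity follow; continuity is read off
from the formula. The hypothesis of the principle comes from the resolvent identity and `∫ ∂̄F = 0`
(`IsHSCalculus.resolvent_comp`).

From the extension to `a`: the operators `R z = B ((z - ·)⁻¹)` satisfy the resolvent identity. The
kernel and range conditions on `A` make `R i` injective with dense range, so `a = i - (R i)⁻¹` is
closed, densely defined and has resolvent `R`. Continuity of `B` along a suitably scaled sequence
forces polynomial growth of `R` (`exists_bound_cauchyG`), and the principle with `c = 0` gives `A =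
[a]`.

Almost holomorphic extensions are built from the Fourier transform: `F(x + iy) = ∫ f̂(ξ) exp(2πi x
ξ) m(yξ) dξ`, where `m` is a compactly supported cutoff of `exp(-2πu)`. -/

/-! ### Continuity estimates for maps on test functions -/

/-- The test function with given underlying smooth compactly supported function. -/
def TestFn.of (f : ℝ → ℂ) (hf : ContDiff ℝ ∞ f) (hc : HasCompactSupport f) : TestFn :=
  ⟨f, hf, hc, fun _ _ => trivial⟩

@[simp]
theorem TestFn.mul_apply (φ ψ : TestFn) (t : ℝ) : φ.mul ψ t = φ t * ψ t := rfl

theorem TestFn.smooth (φ : TestFn) : ContDiff ℝ ∞ φ := φ.contDiff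

theorem TestFn.iteratedDeriv_continuous (φ : TestFn) (i : ℕ) : Continuous (iteratedDeriv i φ) :=
  φ.smooth.continuous_iteratedDeriv i (by exact_mod_cast le_top)

theorem hasCompactSupport_iteratedDeriv {f : ℝ → ℂ} (hf : HasCompactSupport f) (i : ℕ) :
    HasCompactSupport (iteratedDeriv i f) := by
  induction i with
  | zero => simpa using hf
  | succ i ih => rw [iteratedDeriv_succ]; exact ih.deriv

/-- A continuous linear map on test functions is controlled, on test functions with support in a
compact set, by the suprema of finitely many derivatives. -/
theorem exists_bound_iteratedDeriv {W : Type*} [NormedAddCommGroup W] [NormedSpace ℂ W]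
    (A : TestFn →L[ℂ] W) {K : Set ℝ} (hK : IsCompact K) :
    ∃ (N : ℕ) (C : ℝ), 0 ≤ C ∧ ∀ ψ : TestFn, (∀ t ∉ K, ψ t = 0) → ∀ M : ℝ,
      (∀ i ≤ N, ∀ t, ‖iteratedDeriv i ψ t‖ ≤ M) → ‖A ψ‖ ≤ C * M := by
  let K' : TopologicalSpace.Compacts ℝ := ⟨K, hK⟩
  let L : 𝓓_{K'}(ℝ, ℂ) →L[ℂ] W :=
    A.comp (TestFunction.ofSupportedInCLM ℂ (K := K') (fun _ _ => trivial))
  let q : Seminorm ℂ 𝓓_{K'}(ℝ, ℂ) := (normSeminorm ℂ W).comp L.toLinearMap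
  have hq : Continuous q := L.continuous.norm
  obtain ⟨s, C, -, hC⟩ := Seminorm.bound_of_continuous
    (ContDiffMapSupportedIn.withSeminorms ℂ ℝ ℂ ⊤ K') q hq
  refine ⟨s.sup id, C, C.2, fun ψ hψ M hM => ?_⟩
  let ψ' : 𝓓_{K'}(ℝ, ℂ) := ⟨ψ, ψ.smooth, fun t ht => hψ t ht⟩
  have hM0 : 0 ≤ M := (norm_nonneg _).trans (hM 0 (Nat.zero_le _) 0)
  have h1 : ‖A ψ‖ = q ψ' := rfl
  rw [h1]
  refine (hC ψ').trans ?_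
  change C * (s.sup (ContDiffMapSupportedIn.seminorm ℂ ℝ ℂ ⊤ K')) ψ' ≤ C * M
  refine mul_le_mul_of_nonneg_left ?_ C.2
  refine Seminorm.finset_sup_apply_le hM0 fun i hi => ?_
  rw [ContDiffMapSupportedIn.seminorm_top_le_iff ℂ hM0]
  intro t _
  rw [norm_iteratedFDeriv_eq_norm_iteratedDeriv]
  exact hM i (Finset.le_sup (f := id) hi) t

/-- The estimate makes `L` factor through the range of `J`, and Hahn-Banach extends the resulting
functional. Applied to jets, it turns a functional on test functions into one on a Banach space,
where it commutes with Bochner integrals. -/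
theorem exists_extension_of_norm_le {V E : Type*} [AddCommGroup V] [Module ℂ V]
    [NormedAddCommGroup E] [NormedSpace ℂ E] (J : V →ₗ[ℂ] E) (L : V →ₗ[ℂ] ℂ) (C : ℝ)
    (h : ∀ v, ‖L v‖ ≤ C * ‖J v‖) : ∃ g : E →L[ℂ] ℂ, ∀ v, g (J v) = L v := by
  have hker : LinearMap.ker J ≤ LinearMap.ker L := by
    intro v hv
    have := h v
    rw [LinearMap.mem_ker] at hv ⊢
    simpa [hv] using this
  let f₀ : LinearMap.range J →ₗ[ℂ] ℂ :=
    ((LinearMap.ker J).liftQ L hker).comp J.quotKerEquivRange.symm.toLinearMap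
  have hf₀ : ∀ v, f₀ ⟨J v, v, rfl⟩ = L v := by
    intro v
    have : J.quotKerEquivRange.symm ⟨J v, v, rfl⟩ = (LinearMap.ker J).mkQ v := by
      rw [LinearEquiv.symm_apply_eq]
      rfl
    change ((LinearMap.ker J).liftQ L hker) (J.quotKerEquivRange.symm ⟨J v, v, rfl⟩) = _
    rw [this]
    simp
  let f : StrongDual ℂ (LinearMap.range J) := f₀.mkContinuous C (by
    rintro ⟨_, v, rfl⟩
    rw [hf₀]
    exact h v)
  obtain ⟨g, hg, -⟩ := exists_extension_norm_eq (LinearMap.range J) f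
  exact ⟨g, fun v => (hg ⟨J v, v, rfl⟩).trans (hf₀ v)⟩

/-! ### Families of bounded functions with singularities of finite order on the real axis -/

/-- A family of bounded functions, depending continuously on `z ∉ ℝ`, with norm of at most
polynomial growth in `1 / |Im z|`. -/
structure IsModerate {E : Type*} [NormedAddCommGroup E] (H : ℂ → E) : Prop where
  continuousOn : ContinuousOn H {z | z.im ≠ 0}
  bound : ∃ (N : ℕ) (C : ℝ), 0 ≤ C ∧ ∀ z : ℂ, z.im ≠ 0 → ‖H z‖ ≤ C * (1 + 1 / |z.im|) ^ N

theorem IsModerate.const {E : Type*} [NormedAddCommGroup E] (e : E) :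
    IsModerate fun _ : ℂ => e :=
  ⟨continuousOn_const, 0, ‖e‖, norm_nonneg _, fun _ _ => by simp⟩

theorem IsModerate.add {E : Type*} [NormedAddCommGroup E] {H₁ H₂ : ℂ → E} (h₁ : IsModerate H₁)
    (h₂ : IsModerate H₂) : IsModerate fun z => H₁ z + H₂ z := by
  refine ⟨h₁.1.add h₂.1, ?_⟩
  obtain ⟨N₁, C₁, hC₁, b₁⟩ := h₁.2
  obtain ⟨N₂, C₂, hC₂, b₂⟩ := h₂.2
  refine ⟨N₁ + N₂, C₁ + C₂, by positivity, fun z hz => ?_⟩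
  -- The base `1 + 1 / |Im z|` is at least one for every `z`, so both exponents may be raised to `N₁
  -- + N₂`.
  have h : (1 : ℝ) ≤ 1 + 1 / |z.im| := le_add_of_nonneg_right (by positivity)
  calc _ ≤ ‖H₁ z‖ + ‖H₂ z‖ := norm_add_le _ _
    _ ≤ C₁ * (1 + 1 / |z.im|) ^ N₁ + C₂ * (1 + 1 / |z.im|) ^ N₂ := add_le_add (b₁ z hz) (b₂ z hz)
    _ ≤ C₁ * (1 + 1 / |z.im|) ^ (N₁ + N₂) + C₂ * (1 + 1 / |z.im|) ^ (N₁ + N₂) := by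
      gcongr <;> first | exact h | simp
    _ = _ := by ring

theorem IsModerate.mul {E : Type*} [NormedRing E] {H₁ H₂ : ℂ → E} (h₁ : IsModerate H₁)
    (h₂ : IsModerate H₂) : IsModerate fun z => H₁ z * H₂ z := by
  refine ⟨h₁.1.mul h₂.1, ?_⟩
  obtain ⟨N₁, C₁, hC₁, b₁⟩ := h₁.2
  obtain ⟨N₂, C₂, hC₂, b₂⟩ := h₂.2
  refine ⟨N₁ + N₂, C₁ * C₂, by positivity, fun z hz => ?_⟩
  calc _ ≤ ‖H₁ z‖ * ‖H₂ z‖ := norm_mul_le _ _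
    _ ≤ (C₁ * (1 + 1 / |z.im|) ^ N₁) * (C₂ * (1 + 1 / |z.im|) ^ N₂) :=
      mul_le_mul (b₁ z hz) (b₂ z hz) (norm_nonneg _) (by positivity)
    _ = _ := by ring

/-- A function satisfying the resolvent identity is continuous where it is locally bounded. -/
theorem continuousOn_of_resolvent_identity {E : Type*} [NormedRing E] [NormedSpace ℂ E]
    {R : ℂ → E} {U : Set ℂ} (hR : ∀ z ∈ U, ∀ w ∈ U, R w - R z = (z - w) • (R w * R z))
    (hb : ∀ z ∈ U, ∃ M, ∀ᶠ w in 𝓝[U] z, ‖R w‖ ≤ M) : ContinuousOn R U := by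
  intro z hz
  obtain ⟨M, hM⟩ := hb z hz
  rw [ContinuousWithinAt, tendsto_iff_norm_sub_tendsto_zero]
  have hlim : Tendsto (fun w => ‖z - w‖ * (M * ‖R z‖)) (𝓝[U] z) (𝓝 0) := by
    have : Continuous fun w => ‖z - w‖ * (M * ‖R z‖) := by fun_prop
    simpa using (this.tendsto z).mono_left nhdsWithin_le_nhds
  refine squeeze_zero' (Eventually.of_forall fun _ => norm_nonneg _) ?_ hlim
  filter_upwards [hM, self_mem_nhdsWithin] with w hw hwU
  rw [hR z hz w hwU, norm_smul]
  gcongr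
  exact (norm_mul_le _ _).trans (by gcongr)

theorem abs_im_le_norm_sub_ofReal (z : ℂ) (t : ℝ) : |z.im| ≤ ‖z - t‖ := by
  simpa using Complex.abs_im_le_norm (z - t)

theorem sub_ofReal_ne_zero {z : ℂ} (hz : z.im ≠ 0) (t : ℝ) : z - t ≠ 0 := by
  intro h
  apply hz
  simpa using congrArg Complex.im h

theorem norm_inv_sub_ofReal_le {z : ℂ} (hz : z.im ≠ 0) (t : ℝ) : ‖(z - t)⁻¹‖ ≤ 1 / |z.im| := by
  rw [norm_inv, one_div]
  exact inv_anti₀ (abs_pos.2 hz) (abs_im_le_norm_sub_ofReal z t)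

open scoped BoundedContinuousFunction

open Classical in
/-- The function `t ↦ (z - t)⁻¹` on the real line. -/
def cauchyKernel (z : ℂ) : ℝ →ᵇ ℂ :=
  if hz : z.im ≠ 0 then
    BoundedContinuousFunction.ofNormedAddCommGroup (fun t : ℝ => (z - t)⁻¹)
      (Continuous.inv₀ (by fun_prop) (sub_ofReal_ne_zero hz)) (1 / |z.im|)
      (norm_inv_sub_ofReal_le hz)
  else 0

theorem cauchyKernel_apply {z : ℂ} (hz : z.im ≠ 0) (t : ℝ) : cauchyKernel z t = (z - t)⁻¹ := by
  rw [cauchyKernel, dif_pos hz]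
  rfl

theorem norm_cauchyKernel_le {z : ℂ} (hz : z.im ≠ 0) : ‖cauchyKernel z‖ ≤ 1 / |z.im| := by
  rw [BoundedContinuousFunction.norm_le (by positivity)]
  intro t
  rw [cauchyKernel_apply hz]
  exact norm_inv_sub_ofReal_le hz t

theorem eventually_im_ge {z : ℂ} (hz : z.im ≠ 0) : ∀ᶠ w : ℂ in 𝓝 z, |z.im| / 2 ≤ |w.im| := by
  have : Continuous fun w : ℂ => |w.im| := Complex.continuous_im.abs
  exact (this.tendsto z).eventually (Ici_mem_nhds (half_lt_self (abs_pos.2 hz)))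

/-- The scalar resolvent identity holds pointwise in `t`, hence in the sup norm, so continuity
reduces to local boundedness. -/
theorem isModerate_cauchyKernel : IsModerate cauchyKernel := by
  refine ⟨continuousOn_of_resolvent_identity ?_ ?_, 1, 1, zero_le_one, fun z hz => ?_⟩
  · intro z hz w hw
    ext t
    have h1 := sub_ofReal_ne_zero hz t
    have h2 := sub_ofReal_ne_zero hw t
    simp [cauchyKernel_apply hz, cauchyKernel_apply hw]
    field_simp
    ring
  · intro z hz
    refine ⟨1 / (|z.im| / 2), ?_⟩
    filter_upwards [self_mem_nhdsWithin, (eventually_im_ge hz).filter_mono nhdsWithin_le_nhds]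
      with w hw hw'
    have : 0 < |z.im| := abs_pos.2 hz
    exact (norm_cauchyKernel_le hw).trans (by gcongr)
  · have := norm_cauchyKernel_le hz
    rw [pow_one, one_mul]
    linarith

/-- The derivatives of `t ↦ f t / (z - t) ^ m` form a moderate family of bounded functions. -/
theorem exists_isModerate_iteratedDeriv (i : ℕ) : ∀ (f : ℝ → ℂ), ContDiff ℝ ∞ f →
    HasCompactSupport f → ∀ m : ℕ, ∃ H : ℂ → ℝ →ᵇ ℂ, IsModerate H ∧ ∀ z : ℂ, z.im ≠ 0 → ∀ t : ℝ,
      H z t = iteratedDeriv i (fun t : ℝ => f t * ((z - t)⁻¹) ^ m) t := by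
  induction i with
  | zero =>
    intro f hf hc m
    let F : ℝ →ᵇ ℂ := BoundedContinuousFunction.ofNormedAddCommGroup f hf.continuous _
      (hf.continuous.bounded_above_of_compact_support hc).choose_spec
    induction m with
    | zero => exact ⟨fun _ => F, .const F, fun z hz t => by simp [F]⟩
    | succ m ih =>
      obtain ⟨H, hH, h⟩ := ih
      refine ⟨_, hH.mul isModerate_cauchyKernel, fun z hz t => ?_⟩
      have := h z hz t
      simp only [iteratedDeriv_zero, BoundedContinuousFunction.mul_apply,
        cauchyKernel_apply hz] at this ⊢
      rw [this]
      ring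
  | succ i ih =>
    intro f hf hc m
    have hf' : ContDiff ℝ ∞ (deriv f) := (contDiff_infty_iff_deriv.1 hf).2
    -- One derivative of `f (z - t)⁻ᵐ` gives `f' (z - t)⁻ᵐ + m f (z - t)⁻ᵐ⁻¹`. Both terms have the
    -- original shape, which is why the induction runs over all `f` and `m`.
    obtain ⟨H₁, hH₁, h₁⟩ := ih (deriv f) hf' hc.deriv m
    obtain ⟨H₂, hH₂, h₂⟩ := ih (fun t => m * f t) (contDiff_const.mul hf) hc.mul_left (m + 1)
    refine ⟨_, hH₁.add hH₂, fun z hz t => ?_⟩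
    have hk : ContDiff ℝ ∞ fun t : ℝ => (z - t)⁻¹ :=
      ContDiff.inv (contDiff_const.sub Complex.ofRealCLM.contDiff) (sub_ofReal_ne_zero hz)
    have hd : deriv (fun t : ℝ => f t * ((z - t)⁻¹) ^ m) =
        fun t : ℝ => deriv f t * ((z - t)⁻¹) ^ m + m * f t * ((z - t)⁻¹) ^ (m + 1) := by
      ext t
      have hne := sub_ofReal_ne_zero hz t
      have h1 : HasDerivAt f (deriv f t) t :=
        (hf.differentiable (by simp)).differentiableAt.hasDerivAt
      have h2 : HasDerivAt (fun t : ℝ => z - (t : ℂ)) (-1) t := by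
        simpa using (Complex.ofRealCLM.hasDerivAt (x := t)).const_sub z
      have h3 := (h1.mul ((h2.inv hne).pow m)).deriv
      refine h3.trans ?_
      rcases m with _ | m
      · simp
      · simp
        field_simp
        ring
    rw [iteratedDeriv_succ', hd]
    have e1 : ContDiff ℝ i fun t : ℝ => deriv f t * ((z - t)⁻¹) ^ m :=
      (hf'.mul (hk.pow m)).of_le (by exact_mod_cast le_top)
    have e2 : ContDiff ℝ i fun t : ℝ => m * f t * ((z - t)⁻¹) ^ (m + 1) :=
      ((contDiff_const.mul hf).mul (hk.pow (m + 1))).of_le (by exact_mod_cast le_top)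
    rw [iteratedDeriv_fun_add e1.contDiffAt e2.contDiffAt, BoundedContinuousFunction.add_apply,
      h₁ z hz, h₂ z hz]

/-! ### Commuting a map on test functions with a Cauchy integral -/

open Classical in
/-- The test function `t ↦ φ t / (z - t)` for `z ∉ ℝ`. -/
def TestFn.divSub (φ : TestFn) (z : ℂ) : TestFn :=
  if hz : z.im ≠ 0 then
    TestFn.of (fun t => φ t * (z - t)⁻¹)
      (φ.smooth.mul (ContDiff.inv (contDiff_const.sub Complex.ofRealCLM.contDiff)
        (sub_ofReal_ne_zero hz))) φ.hasCompactSupport.mul_right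
  else 0

theorem TestFn.divSub_apply (φ : TestFn) {z : ℂ} (hz : z.im ≠ 0) (t : ℝ) :
    φ.divSub z t = φ t * (z - t)⁻¹ := by
  rw [TestFn.divSub, dif_pos hz]
  rfl

/-- On the real axis `cauchyKernel` and `TestFn.divSub` are zero by convention and `pmapResolvent`
is uncontrolled; the axis is a null set, so the integrals do not see it. -/
theorem ae_im_ne_zero : ∀ᵐ z : ℂ, z.im ≠ 0 := by
  rw [ae_iff]
  simp only [ne_eq, not_not]
  let S : Submodule ℝ ℂ := LinearMap.ker Complex.imLm
  have hS : S ≠ ⊤ := by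
    intro h
    have : Complex.I ∈ S := h ▸ Submodule.mem_top
    simp [S] at this
  exact Measure.addHaar_submodule volume S hS

/-- A function on the plane with compact support that vanishes to infinite order on the real
axis. -/
structure IsFlat (κ : ℂ → ℂ) : Prop where
  continuous : Continuous κ
  hasCompactSupport : HasCompactSupport κ
  flat : ∀ N : ℕ, ∃ C : ℝ, ∀ z, ‖κ z‖ ≤ C * |z.im| ^ N

theorem aestronglyMeasurable_of_continuousOn_im_ne_zero {E : Type*} [NormedAddCommGroup E]
    {H : ℂ → E} (hH : ContinuousOn H {z | z.im ≠ 0}) : AEStronglyMeasurable H := by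
  have hopen : IsOpen {z : ℂ | z.im ≠ 0} := isOpen_ne_fun Complex.continuous_im continuous_const
  have := hH.aestronglyMeasurable (μ := volume) hopen.measurableSet
  rwa [Measure.restrict_eq_self_of_ae_mem (s := {z : ℂ | z.im ≠ 0}) ae_im_ne_zero] at this

/-- The product of a flat function and a function which is locally `O(|Im z|^{-N})` is
integrable. -/
theorem IsFlat.integrable_smul_of_bound {E : Type*} [NormedAddCommGroup E] [NormedSpace ℂ E]
    {κ : ℂ → ℂ} (hκ : IsFlat κ) {H : ℂ → E} (hH : ContinuousOn H {z | z.im ≠ 0}) {N : ℕ} {C : ℝ}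
    (hb : ∀ z ∈ tsupport κ, z.im ≠ 0 → ‖H z‖ ≤ C * (1 / |z.im|) ^ N) :
    Integrable fun z => κ z • H z := by
  obtain ⟨C', hC'⟩ := hκ.flat N
  have hfin : volume (tsupport κ) < ⊤ := hκ.hasCompactSupport.measure_lt_top
  have hdom : Integrable ((tsupport κ).indicator fun _ : ℂ => C' * C) :=
    (integrable_indicator_iff (isClosed_tsupport κ).measurableSet).2
      (integrableOn_const hfin.ne)
  refine hdom.mono' (hκ.continuous.aestronglyMeasurable.smul
    (aestronglyMeasurable_of_continuousOn_im_ne_zero hH)) ?_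
  filter_upwards [ae_im_ne_zero] with z hz
  by_cases hzs : z ∈ tsupport κ
  · rw [Set.indicator_of_mem hzs, norm_smul]
    have hz' : 0 < |z.im| := abs_pos.2 hz
    calc ‖κ z‖ * ‖H z‖ ≤ (C' * |z.im| ^ N) * (C * (1 / |z.im|) ^ N) :=
          mul_le_mul (hC' z) (hb z hzs hz) (norm_nonneg _) ((norm_nonneg _).trans (hC' z))
      _ = C' * C := by
          rw [mul_mul_mul_comm, ← mul_pow, mul_one_div_cancel hz'.ne', one_pow, mul_one]
  · rw [Set.indicator_of_notMem hzs, image_eq_zero_of_notMem_tsupport hzs]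
    simp

theorem IsFlat.integrable_smul {E : Type*} [NormedAddCommGroup E] [NormedSpace ℂ E]
    {κ : ℂ → ℂ} (hκ : IsFlat κ) {H : ℂ → E} (hH : IsModerate H) :
    Integrable fun z => κ z • H z := by
  obtain ⟨N, C, hC, hb⟩ := hH.bound
  obtain ⟨M, hM⟩ := hκ.hasCompactSupport.isCompact.isBounded.exists_norm_le
  -- On the support `|Im z| ≤ |M|`, hence `1 + 1 / |Im z| ≤ (1 + |M|) / |Im z|`.
  refine hκ.integrable_smul_of_bound hH.continuousOn (N := N) (C := C * (1 + |M|) ^ N)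
    fun z hzs hz => (hb z hz).trans ?_
  have hz' : 0 < |z.im| := abs_pos.2 hz
  have h1 : |z.im| ≤ |M| := (Complex.abs_im_le_norm z).trans ((hM z hzs).trans (le_abs_self M))
  rw [mul_assoc, ← mul_pow]
  gcongr
  rw [mul_one_div, le_div_iff₀ hz', add_mul, one_div, inv_mul_cancel₀ hz'.ne']
  linarith

/-- Test functions vanishing outside of `K`. -/
def testFnOn (K : Set ℝ) : Submodule ℂ TestFn where
  carrier := {ψ | ∀ t ∉ K, ψ t = 0}
  add_mem' := fun ha hb t ht => by
    rw [add_apply, ha t ht, hb t ht, add_zero]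
  zero_mem' := fun _ _ => rfl
  smul_mem' := fun c a ha t ht => by
    rw [smul_apply, ha t ht, smul_zero]

/-- The derivatives of order at most `N` of a test function. -/
def jet (N : ℕ) : TestFn →ₗ[ℂ] (Fin (N + 1) → ℝ →ᵇ ℂ) where
  toFun ψ i := BoundedContinuousFunction.ofNormedAddCommGroup (iteratedDeriv i ψ)
    (ψ.iteratedDeriv_continuous i) _
    ((ψ.iteratedDeriv_continuous i).bounded_above_of_compact_support
      (hasCompactSupport_iteratedDeriv ψ.hasCompactSupport i)).choose_spec
  map_add' φ ψ := by
    ext i t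
    have h (χ : TestFn) : ContDiffAt ℝ i χ t :=
      (χ.smooth.of_le (by exact_mod_cast le_top)).contDiffAt
    exact iteratedDeriv_add (h φ) (h ψ)
  map_smul' c ψ := by
    ext i t
    have h : ContDiffAt ℝ i ψ t := (ψ.smooth.of_le (by exact_mod_cast le_top)).contDiffAt
    exact iteratedDeriv_const_smul h c

@[simp]
theorem jet_apply (N : ℕ) (ψ : TestFn) (i : Fin (N + 1)) (t : ℝ) :
    jet N ψ i t = iteratedDeriv i ψ t := rfl

theorem hasDerivAt_iteratedDeriv {f : ℝ → ℂ} (hf : ContDiff ℝ ∞ f) (i : ℕ) (t : ℝ) :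
    HasDerivAt (iteratedDeriv i f) (iteratedDeriv (i + 1) f t) t := by
  rw [iteratedDeriv_succ]
  exact (hf.differentiable_iteratedDeriv i (by exact_mod_cast WithTop.coe_lt_top i)
    |>.differentiableAt).hasDerivAt

/-- A continuous linear map on test functions commutes with the integral of the Cauchy kernels
`t ↦ φ t / (z - t)` against a flat function of `z`. -/
theorem map_cauchyIntegral {W : Type*} [NormedAddCommGroup W] [NormedSpace ℂ W] [CompleteSpace W]
    (A : TestFn →L[ℂ] W) {κ : ℂ → ℂ} (hκ : IsFlat κ) (φ χ : TestFn)
    (hχ : ∀ t : ℝ, χ t = φ t * ∫ z : ℂ, κ z / (z - t))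
    (hint : Integrable fun z => κ z • A (φ.divSub z)) :
    A χ = ∫ z, κ z • A (φ.divSub z) := by
  choose H hH hHφ using fun i : ℕ =>
    exists_isModerate_iteratedDeriv i φ φ.smooth φ.hasCompactSupport 1
  have hHd : ∀ i, ∀ z : ℂ, z.im ≠ 0 → ∀ t : ℝ, H i z t = iteratedDeriv i (φ.divSub z) t := by
    intro i z hz t
    rw [hHφ i z hz t]
    congr 1
    ext t
    rw [TestFn.divSub_apply φ hz, pow_one]
  have hHint (i : ℕ) : Integrable fun z => κ z • H i z := hκ.integrable_smul (hH i)
  have happ (i : ℕ) (t : ℝ) : (∫ z, κ z • H i z) t = ∫ z, κ z * H i z t :=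
    ((BoundedContinuousFunction.evalCLM ℂ t).integral_comp_comm (hHint i)).symm
  -- Differentiation under the integral sign, one order at a time; the dominating function is the
  -- sup norm in `t` of the next derivative, integrable because `κ` is flat.
  have hderiv (i : ℕ) : ∀ t, iteratedDeriv i χ t = (∫ z, κ z • H i z) t := by
    induction i with
    | zero =>
      intro t
      rw [iteratedDeriv_zero, hχ, happ, ← integral_const_mul]
      refine integral_congr_ae ?_
      filter_upwards [ae_im_ne_zero] with z hz
      rw [hHφ 0 z hz, iteratedDeriv_zero]
      ring
    | succ i ih =>
      intro t
      have h1 := (hasDerivAt_integral_of_dominated_loc_of_deriv_le (μ := volume)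
        (F := fun (t : ℝ) (z : ℂ) => κ z * H i z t) (F' := fun t z => κ z * H (i + 1) z t)
        (x₀ := t) (s := Set.univ) (bound := fun z => ‖κ z • H (i + 1) z‖) univ_mem
        (Eventually.of_forall fun t => ((BoundedContinuousFunction.evalCLM ℂ t).integrable_comp
          (hHint i)).aestronglyMeasurable)
        ((BoundedContinuousFunction.evalCLM ℂ t).integrable_comp (hHint i))
        ((BoundedContinuousFunction.evalCLM ℂ t).integrable_comp
          (hHint (i + 1))).aestronglyMeasurable
        (Eventually.of_forall fun z t _ =>
          BoundedContinuousFunction.norm_coe_le_norm (κ z • H (i + 1) z) t)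
        (hHint (i + 1)).norm ?_).2
      · rw [iteratedDeriv_succ, funext ih, happ]
        exact ((funext (happ i)) ▸ h1 : HasDerivAt _ _ t).deriv
      · filter_upwards [ae_im_ne_zero] with z hz t _
        rw [funext (hHd i z hz), hHd (i + 1) z hz]
        exact (hasDerivAt_iteratedDeriv (φ.divSub z).smooth i t).const_mul _
  have hK : IsCompact (tsupport φ) := φ.hasCompactSupport
  obtain ⟨N, C, hC, hA⟩ := exists_bound_iteratedDeriv A hK
  have hdiv : ∀ z, φ.divSub z ∈ testFnOn (tsupport φ) := by
    intro z t ht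
    by_cases hz : z.im ≠ 0
    · rw [TestFn.divSub_apply φ hz, image_eq_zero_of_notMem_tsupport ht, zero_mul]
    · rw [TestFn.divSub, dif_neg hz]
      rfl
  have hχs : χ ∈ testFnOn (tsupport φ) := fun t ht => by
    rw [hχ, image_eq_zero_of_notMem_tsupport ht, zero_mul]
  -- The integral is taken in the Banach space of `N`-jets instead of `𝒟(ℝ)`. On test functions
  -- supported in `tsupport φ`, `ℓ ∘ A` is bounded by the `N`-jet, so it is the restriction of a
  -- continuous functional `g` on jets, and `g` passes through the integral.
  refine (SeparatingDual.eq_iff_forall_dual_eq (R := ℂ)).2 fun ℓ => ?_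
  obtain ⟨g, hg⟩ := exists_extension_of_norm_le
    ((jet N).comp (testFnOn (tsupport φ)).subtype)
    ((ℓ.comp A).toLinearMap.comp (testFnOn (tsupport φ)).subtype) (‖ℓ‖ * C) (by
      rintro ⟨ψ, hψ⟩
      refine (ℓ.le_opNorm (A ψ)).trans ?_
      rw [mul_assoc]
      refine mul_le_mul_of_nonneg_left (hA ψ hψ _ fun i hi t => ?_) (norm_nonneg _)
      exact ((jet N ψ ⟨i, Nat.lt_succ_of_le hi⟩).norm_coe_le_norm t).trans
        (norm_le_pi_norm (jet N ψ) _))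
  have hg' (ψ : TestFn) (hψ : ψ ∈ testFnOn (tsupport φ)) : g (jet N ψ) = ℓ (A ψ) := hg ⟨ψ, hψ⟩
  let HN : ℂ → Fin (N + 1) → ℝ →ᵇ ℂ := fun z i => H i z
  have hjd : ∀ z : ℂ, z.im ≠ 0 → jet N (φ.divSub z) = HN z := by
    intro z hz
    ext i t
    exact (hHd i z hz t).symm
  have hHN : Integrable fun z => κ z • HN z := Integrable.of_eval fun i => hHint i
  have hjχ : jet N χ = ∫ z, κ z • HN z := by
    ext i t
    rw [jet_apply, hderiv i t, eval_integral (f := fun z => κ z • HN z) (fun i => hHint i) i]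
    rfl
  rw [← ℓ.integral_comp_comm hint, ← hg' χ hχs, hjχ, ← g.integral_comp_comm hHN]
  refine integral_congr_ae ?_
  filter_upwards [ae_im_ne_zero] with z hz
  rw [map_smul, map_smul, ← hjd z hz, hg' _ (hdiv z)]

/-! ### The Cauchy-Riemann operator and the Cauchy-Pompeiu formula -/

theorem dbar_congr {F G : ℂ → ℂ} {z : ℂ} (h : F =ᶠ[𝓝 z] G) : dbar F z = dbar G z := by
  rw [dbar, dbar, h.fderiv_eq]

theorem dbar_mul {F G : ℂ → ℂ} {z : ℂ} (hF : DifferentiableAt ℝ F z)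
    (hG : DifferentiableAt ℝ G z) :
    dbar (fun w => F w * G w) z = F z * dbar G z + dbar F z * G z := by
  simp only [dbar, fderiv_fun_mul hF hG, add_apply, smul_apply, smul_eq_mul]
  ring

theorem dbar_const_sub (c : ℂ) (F : ℂ → ℂ) (z : ℂ) : dbar (fun w => c - F w) z = -dbar F z := by
  simp only [dbar, fderiv_const_sub, neg_apply]
  ring

theorem dbar_eq_zero_of_differentiableAt {F : ℂ → ℂ} {z : ℂ} (h : DifferentiableAt ℂ F z) :
    dbar F z = 0 := by
  have h1 : HasFDerivAt F ((fderiv ℂ F z).restrictScalars ℝ) z := h.hasFDerivAt.restrictScalars ℝ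
  have h2 : fderiv ℂ F z Complex.I = Complex.I * fderiv ℂ F z 1 := by
    conv_lhs => rw [← mul_one Complex.I, ← smul_eq_mul, map_smul, smul_eq_mul]
  rw [dbar, h1.fderiv]
  simp only [ContinuousLinearMap.coe_restrictScalars']
  rw [h2, ← mul_assoc, Complex.I_mul_I]
  ring

theorem continuous_dbar {F : ℂ → ℂ} (hF : ContDiff ℝ 1 F) : Continuous (dbar F) := by
  have := hF.continuous_fderiv one_ne_zero
  unfold dbar
  fun_prop

theorem tsupport_dbar_subset (F : ℂ → ℂ) : tsupport (dbar F) ⊆ tsupport F := by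
  refine closure_minimal (fun z hz => ?_) (isClosed_tsupport F)
  by_contra h
  apply hz
  have : F =ᶠ[𝓝 z] fun _ => 0 := notMem_tsupport_iff_eventuallyEq.1 h
  rw [dbar_congr this]
  simp [dbar]

theorem hasCompactSupport_dbar {F : ℂ → ℂ} (hF : HasCompactSupport F) :
    HasCompactSupport (dbar F) :=
  hF.of_isClosed_subset (isClosed_tsupport _) (tsupport_dbar_subset F)

/-- This is the polar form `e^{-iθ} ∂̄ = (∂_r + i r⁻¹ ∂_θ) / 2`: the derivatives along `e^{iθ}` and
`i e^{iθ}` are `∂_r` and `r⁻¹ ∂_θ`. -/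
theorem exp_neg_mul_dbar (F : ℂ → ℂ) (z : ℂ) (θ : ℝ) :
    Complex.exp (-(θ * Complex.I)) * dbar F z =
      (1 / 2 : ℂ) * (fderiv ℝ F z (Complex.exp (θ * Complex.I)) +
        Complex.I * fderiv ℝ F z (Complex.I * Complex.exp (θ * Complex.I))) := by
  have h1 : Complex.exp (θ * Complex.I) = (Real.cos θ) • (1 : ℂ) + (Real.sin θ) • Complex.I := by
    rw [Complex.exp_mul_I]
    simp
  have h2 : Complex.I * Complex.exp (θ * Complex.I) =
      (-Real.sin θ) • (1 : ℂ) + (Real.cos θ) • Complex.I := by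
    rw [Complex.exp_mul_I]
    simp only [Complex.real_smul, Complex.ofReal_neg, Complex.ofReal_cos, Complex.ofReal_sin]
    ring_nf
    simp
    ring
  have h3 : Complex.exp (-(θ * Complex.I)) = Real.cos θ - Real.sin θ * Complex.I := by
    rw [← neg_mul, Complex.exp_mul_I]
    simp [sub_eq_add_neg]
  rw [h2, h1, h3, dbar]
  rw [map_add, map_add, map_smul, map_smul, map_smul, map_smul]
  simp only [Complex.real_smul]
  push_cast
  ring_nf
  simp only [Complex.I_sq]
  ring

theorem map_ofReal_mul (L : ℂ →L[ℝ] ℂ) (r : ℝ) (v : ℂ) : L (r * v) = r * L v := by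
  rw [← Complex.real_smul, map_smul, Complex.real_smul]

/-- The Cauchy-Pompeiu formula on a disc outside of which the function is holomorphic. -/
theorem integral_dbar_div_eq_circle {Ψ : ℂ → ℂ} (hΨ : ContDiff ℝ 1 Ψ) (t : ℂ) {S : ℝ} (hS : 0 < S)
    (h0 : ∀ z : ℂ, S ≤ ‖z - t‖ → dbar Ψ z = 0) :
    ∫ z, dbar Ψ z / (z - t) = (1 / 2 : ℂ) * ∫ θ in (-Real.pi)..Real.pi,
      (Ψ (t + S * Complex.exp (θ * Complex.I)) - Ψ t) := by
  let e : ℝ → ℂ := fun θ => Complex.exp (θ * Complex.I)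
  have he : Continuous e := by fun_prop
  have hfd : Continuous (fderiv ℝ Ψ) := hΨ.continuous_fderiv one_ne_zero
  let G₁ : ℝ → ℝ → ℂ := fun r θ => fderiv ℝ Ψ (t + r * e θ) (e θ)
  let G₂ : ℝ → ℝ → ℂ := fun r θ => fderiv ℝ Ψ (t + r * e θ) (Complex.I * e θ)
  have hG₁ : Continuous (Function.uncurry G₁) := by
    have : Continuous fun p : ℝ × ℝ => fderiv ℝ Ψ (t + p.1 * e p.2) (e p.2) := by fun_prop
    exact this
  have hG₂ : Continuous (Function.uncurry G₂) := by
    have : Continuous fun p : ℝ × ℝ => fderiv ℝ Ψ (t + p.1 * e p.2) (Complex.I * e p.2) := by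
      fun_prop
    exact this
  have hdΨ : ∀ z, HasFDerivAt Ψ (fderiv ℝ Ψ z) z := fun z =>
    (hΨ.differentiable one_ne_zero z).hasFDerivAt
  have hr : ∀ θ, ∫ r in (0 : ℝ)..S, G₁ r θ = Ψ (t + S * e θ) - Ψ t := by
    intro θ
    have hd : ∀ r ∈ Set.uIcc 0 S, HasDerivAt (fun r : ℝ => Ψ (t + r * e θ)) (G₁ r θ) r := by
      intro r _
      have h1 : HasDerivAt (fun r : ℝ => t + (r : ℂ) * e θ) (e θ) r := by
        simpa using ((Complex.ofRealCLM.hasDerivAt (x := r)).mul_const (e θ)).const_add t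
      exact (hdΨ _).comp_hasDerivAt r h1
    rw [intervalIntegral.integral_eq_sub_of_hasDerivAt hd]
    · simp
    · exact (hG₁.comp (by fun_prop : Continuous fun r : ℝ => (r, θ))).intervalIntegrable _ _
  -- The tangential derivative is the `θ`-derivative of a periodic function divided by `r`, so it
  -- integrates to zero over the circle.
  have hθ : ∀ r : ℝ, 0 < r → ∫ θ in (-Real.pi)..Real.pi, G₂ r θ = 0 := by
    intro r hr
    have hd : ∀ θ ∈ Set.uIcc (-Real.pi) Real.pi,
        HasDerivAt (fun θ : ℝ => Ψ (t + r * e θ)) (r * G₂ r θ) θ := by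
      intro θ _
      have h2 : HasDerivAt e (Complex.I * e θ) θ := by
        have := ((Complex.ofRealCLM.hasDerivAt (x := θ)).mul_const Complex.I).cexp
        rw [mul_comm]
        simpa using this
      have h1 : HasDerivAt (fun θ : ℝ => t + (r : ℂ) * e θ) (r * (Complex.I * e θ)) θ :=
        (h2.const_mul (r : ℂ)).const_add t
      have h3 := (hdΨ _).comp_hasDerivAt θ h1
      rw [map_ofReal_mul] at h3
      exact h3
    have h4 := intervalIntegral.integral_eq_sub_of_hasDerivAt hd
      ((continuous_const.mul (hG₂.comp (by fun_prop : Continuous fun θ : ℝ => (r, θ)))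
        ).intervalIntegrable _ _)
    have h5 : e Real.pi = e (-Real.pi) := by
      simp only [e, Complex.ofReal_neg, neg_mul, Complex.exp_neg, Complex.exp_pi_mul_I]
      norm_num
    rw [h5, sub_self, intervalIntegral.integral_const_mul] at h4
    exact (mul_eq_zero.1 h4).resolve_left (by exact_mod_cast hr.ne')
  have htrans : ∫ z, dbar Ψ z / (z - t) = ∫ z, dbar Ψ (t + z) / z := by
    rw [← integral_add_left_eq_self (fun z => dbar Ψ z / (z - t)) t]
    simp
  -- The Jacobian `r` cancels the modulus of the denominator `z - t`, leaving the bounded integrand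
  -- `e^{-iθ} ∂̄Ψ`, which vanishes for `r > S`.
  have hpolar : ∀ p ∈ polarCoord.target, p.1 • (dbar Ψ (t + Complex.polarCoord.symm p) /
      Complex.polarCoord.symm p) =
      ((Set.Ioc 0 S) ×ˢ (Set.Ioo (-Real.pi) Real.pi)).indicator
        (fun p : ℝ × ℝ => (1 / 2 : ℂ) * (G₁ p.1 p.2 + Complex.I * G₂ p.1 p.2)) p := by
    rintro ⟨r, θ⟩ ⟨hr0, hθ'⟩
    have hr0' : (0 : ℝ) < r := hr0
    have hpc : Complex.polarCoord.symm (r, θ) = r * e θ := by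
      rw [Complex.polarCoord_symm_apply]
      simp only [e, Complex.exp_mul_I, Complex.ofReal_cos, Complex.ofReal_sin]
    have hne : (r : ℂ) ≠ 0 := by exact_mod_cast hr0'.ne'
    have hexp : r • (dbar Ψ (t + r * e θ) / (r * e θ)) =
        Complex.exp (-(θ * Complex.I)) * dbar Ψ (t + r * e θ) := by
      rw [Complex.exp_neg, Complex.real_smul]
      have : e θ ≠ 0 := Complex.exp_ne_zero _
      change _ = (e θ)⁻¹ * _
      field_simp
    rw [hpc, hexp]
    by_cases hrS : r ≤ S
    · rw [Set.indicator_of_mem (show (r, θ) ∈ (Set.Ioc 0 S) ×ˢ (Set.Ioo (-Real.pi) Real.pi)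
        from ⟨⟨hr0', hrS⟩, hθ'⟩), exp_neg_mul_dbar]
    · rw [Set.indicator_of_notMem fun h => hrS h.1.2, h0, mul_zero]
      simp only [add_sub_cancel_left, norm_mul, Complex.norm_real, Real.norm_eq_abs, e,
        Complex.norm_exp_ofReal_mul_I, mul_one, abs_of_pos hr0']
      exact (not_le.1 hrS).le
  have hsub : (Set.Ioc 0 S) ×ˢ (Set.Ioo (-Real.pi) Real.pi) ⊆ polarCoord.target := by
    rintro ⟨r, θ⟩ ⟨h1, h2⟩
    exact ⟨h1.1, h2⟩
  have hmeas : MeasurableSet ((Set.Ioc 0 S) ×ˢ (Set.Ioo (-Real.pi) Real.pi)) :=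
    measurableSet_Ioc.prod measurableSet_Ioo
  have hG : Continuous fun p : ℝ × ℝ => (1 / 2 : ℂ) * (G₁ p.1 p.2 + Complex.I * G₂ p.1 p.2) := by
    have h1 : Continuous fun p : ℝ × ℝ => G₁ p.1 p.2 := hG₁
    have h2 : Continuous fun p : ℝ × ℝ => G₂ p.1 p.2 := hG₂
    fun_prop
  have hintG : IntegrableOn (fun p : ℝ × ℝ => (1 / 2 : ℂ) * (G₁ p.1 p.2 + Complex.I * G₂ p.1 p.2))
      ((Set.Ioc 0 S) ×ˢ (Set.Ioo (-Real.pi) Real.pi)) (volume.prod volume) :=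
    (hG.continuousOn.integrableOn_compact (μ := volume)
      (isCompact_Icc.prod (isCompact_Icc (a := -Real.pi) (b := Real.pi)))).mono_set
      (Set.prod_mono Set.Ioc_subset_Icc_self Set.Ioo_subset_Icc_self)
  have hpi : -Real.pi ≤ Real.pi := by linarith [Real.pi_pos]
  rw [htrans, ← Complex.integral_comp_polarCoord_symm,
    setIntegral_congr_fun polarCoord.open_target.measurableSet hpolar,
    setIntegral_indicator hmeas, Set.inter_eq_self_of_subset_right hsub, Measure.volume_eq_prod,
    setIntegral_prod _ hintG]
  have hslice : ∀ H : ℝ → ℝ → ℂ, Continuous (Function.uncurry H) → ∀ r a b,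
      IntervalIntegrable (fun θ => H r θ) volume a b := fun H hH r a b =>
    (hH.comp (by fun_prop : Continuous fun θ : ℝ => (r, θ))).intervalIntegrable a b
  have hinner : ∀ r ∈ Set.Ioc 0 S, (∫ θ in Set.Ioo (-Real.pi) Real.pi,
      (1 / 2 : ℂ) * (G₁ r θ + Complex.I * G₂ r θ)) =
      (1 / 2 : ℂ) * ∫ θ in (-Real.pi)..Real.pi, G₁ r θ := by
    intro r hr
    rw [← integral_Ioc_eq_integral_Ioo, ← intervalIntegral.integral_of_le hpi,
      intervalIntegral.integral_const_mul, intervalIntegral.integral_add (hslice G₁ hG₁ r _ _)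
        ((hslice G₂ hG₂ r _ _).const_mul _), intervalIntegral.integral_const_mul, hθ r hr.1,
      mul_zero, add_zero]
  rw [setIntegral_congr_fun measurableSet_Ioc hinner, ← intervalIntegral.integral_of_le hS.le,
    intervalIntegral.integral_const_mul, intervalIntegral_intervalIntegral_swap]
  · simp only [hr, e]
  · rw [Set.uIoc_of_le hS.le, Set.uIoc_of_le hpi]
    exact (hG₁.continuousOn.integrableOn_compact (μ := volume)
      (isCompact_Icc.prod (isCompact_Icc (a := -Real.pi) (b := Real.pi)))).mono_set
      (Set.prod_mono Set.Ioc_subset_Icc_self Set.Ioc_subset_Icc_self)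

/-- The Cauchy-Pompeiu formula for a function which is holomorphic outside of a compact set and
has a limit at infinity. -/
theorem integral_dbar_div {Ψ : ℂ → ℂ} (hΨ : ContDiff ℝ 1 Ψ) (hc : HasCompactSupport (dbar Ψ))
    {c : ℂ} (hlim : Tendsto Ψ (cocompact ℂ) (𝓝 c)) (t : ℂ) :
    ∫ z, dbar Ψ z / (z - t) = Real.pi * (c - Ψ t) := by
  obtain ⟨M, hM⟩ := hc.isCompact.isBounded.subset_closedBall t
  -- `m S` is `π` times the difference between the mean of `Ψ` on the circle of radius `S` and `Ψ
  -- t`. It equals the integral for all large `S` and tends to `π (c - Ψ t)`.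
  let m : ℝ → ℂ := fun S => (1 / 2 : ℂ) * ∫ θ in (-Real.pi)..Real.pi,
      (Ψ (t + S * Complex.exp (θ * Complex.I)) - Ψ t)
  have hev : ∀ᶠ S in atTop, ∫ z, dbar Ψ z / (z - t) = m S := by
    filter_upwards [eventually_gt_atTop M, eventually_gt_atTop 0] with S hS hS0
    refine integral_dbar_div_eq_circle hΨ t hS0 fun z hz => ?_
    by_contra hne
    have := hM (subset_tsupport _ hne)
    rw [Metric.mem_closedBall, dist_eq_norm] at this
    linarith
  have hlim' : Tendsto m atTop (𝓝 (Real.pi * (c - Ψ t))) := by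
    rw [Metric.tendsto_atTop]
    intro ε hε
    have h1 : ∀ᶠ z in cocompact ℂ, ‖Ψ z - c‖ < ε / (2 * Real.pi) := by
      have := hlim.eventually (Metric.ball_mem_nhds c (ε := ε / (2 * Real.pi)) (by positivity))
      simpa only [Metric.mem_ball, dist_eq_norm] using this
    rw [← Metric.cobounded_eq_cocompact,
      (Metric.hasBasis_cobounded_compl_closedBall t).eventually_iff] at h1
    obtain ⟨S₀, -, hS₀⟩ := h1
    refine ⟨|S₀| + 1, fun S hS => ?_⟩
    have hcont : Continuous fun θ : ℝ => Ψ (t + S * Complex.exp (θ * Complex.I)) := by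
      have := hΨ.continuous
      fun_prop
    have h2 : m S - Real.pi * (c - Ψ t) = (1 / 2 : ℂ) * ∫ θ in (-Real.pi)..Real.pi,
        (Ψ (t + S * Complex.exp (θ * Complex.I)) - c) := by
      simp only [m]
      rw [intervalIntegral.integral_sub (hcont.intervalIntegrable _ _) (by simp),
        intervalIntegral.integral_sub (hcont.intervalIntegrable _ _) (by simp)]
      simp only [intervalIntegral.integral_const, Complex.real_smul]
      push_cast
      ring
    have h3 : ‖∫ θ in (-Real.pi)..Real.pi, (Ψ (t + S * Complex.exp (θ * Complex.I)) - c)‖ ≤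
        ε / (2 * Real.pi) * |Real.pi - -Real.pi| := by
      refine intervalIntegral.norm_integral_le_of_norm_le_const fun θ _ => (hS₀ ?_).le
      have hS' : S₀ < S := by linarith [le_abs_self S₀]
      have hS0 : 0 ≤ S := by linarith [abs_nonneg S₀]
      simpa [abs_of_nonneg hS0] using hS'
    rw [dist_eq_norm, h2, norm_mul]
    rw [abs_of_pos (by linarith [Real.pi_pos])] at h3
    have h4 : ε / (2 * Real.pi) * (Real.pi - -Real.pi) = ε := by
      field_simp
      ring
    rw [h4] at h3
    have h5 : ‖(1 / 2 : ℂ)‖ = 1 / 2 := by norm_num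
    rw [h5]
    linarith
  exact tendsto_nhds_unique (tendsto_const_nhds.congr' hev) hlim'

/-- Cauchy-Pompeiu at the origin for `z F(z)`: its `∂̄` is `z ∂̄F`, which cancels the kernel `1 /
z`, and both its value at `0` and its limit at infinity vanish. -/
theorem integral_dbar_eq_zero {F : ℂ → ℂ} (hF : ContDiff ℝ 1 F) (hc : HasCompactSupport F) :
    ∫ z, dbar F z = 0 := by
  have h1 : ContDiff ℝ 1 fun z : ℂ => z * F z := contDiff_id.mul hF
  have h2 : HasCompactSupport fun z : ℂ => z * F z := hc.mul_left
  have h3 := integral_dbar_div h1 (hasCompactSupport_dbar h2) h2.is_zero_at_infty 0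
  rw [zero_mul, sub_zero, mul_zero] at h3
  rw [← h3]
  have hae : ∀ᵐ z : ℂ, z ≠ 0 := by
    simp [ae_iff]
  refine integral_congr_ae ?_
  filter_upwards [hae] with z hz
  rw [dbar_mul differentiableAt_fun_id (hF.differentiable one_ne_zero z),
    dbar_eq_zero_of_differentiableAt differentiableAt_fun_id]
  simp
  field_simp

/-! ### Almost holomorphic extensions -/

open scoped FourierTransform

theorem exists_smooth_cutoff (E : Type*) [NormedAddCommGroup E] [InnerProductSpace ℝ E]
    [FiniteDimensional ℝ E] {r : ℝ} (hr : 0 < r) :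
    ∃ χ : E → ℂ, ContDiff ℝ ∞ χ ∧ HasCompactSupport χ ∧ (∀ x, ‖x‖ ≤ r → χ x = 1) ∧
      (∀ x, r + 1 ≤ ‖x‖ → χ x = 0) ∧ ∀ x, ‖χ x‖ ≤ 1 := by
  let b : ContDiffBump (0 : E) := ⟨r, r + 1, hr, by linarith⟩
  refine ⟨fun x => (b x : ℂ), Complex.ofRealCLM.contDiff.comp b.contDiff,
    b.hasCompactSupport.comp_left (g := fun x : ℝ => (x : ℂ)) rfl, fun x hx => ?_, fun x hx => ?_,
    fun x => ?_⟩
  · simpa using b.one_of_mem_closedBall (by simpa using hx)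
  · simpa using b.zero_of_le_dist (by simpa using hx)
  · rw [Complex.norm_real, Real.norm_eq_abs, abs_of_nonneg b.nonneg]
    exact b.le_one

/-- A continuous function on the line all of whose absolute moments are finite. -/
structure HasMoments (p : ℝ → ℂ) : Prop where
  continuous : Continuous p
  integrable : ∀ n : ℕ, Integrable fun ξ : ℝ => |ξ| ^ n * ‖p ξ‖

theorem HasMoments.id_mul {p : ℝ → ℂ} (hp : HasMoments p) : HasMoments fun ξ => ξ * p ξ := by
  refine ⟨by have := hp.continuous; fun_prop, fun n => ?_⟩
  convert hp.integrable (n + 1) using 2 with ξ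
  rw [norm_mul, Complex.norm_real, Real.norm_eq_abs]
  ring

theorem HasMoments.const_mul {p : ℝ → ℂ} (hp : HasMoments p) (c : ℂ) :
    HasMoments fun ξ => c * p ξ := by
  refine ⟨by have := hp.continuous; fun_prop, fun n => ?_⟩
  convert (hp.integrable n).const_mul ‖c‖ using 2 with ξ
  rw [norm_mul]
  ring

/-- The oscillatory integral `∫ p(ξ) e^{2πi x ξ} m(y ξ) dξ` as a function of `x + i y`. -/
def osc (p m : ℝ → ℂ) (z : ℂ) : ℂ :=
  ∫ ξ : ℝ, p ξ * Complex.exp (2 * Real.pi * Complex.I * (z.re * ξ)) * m (z.im * ξ)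

theorem norm_exp_two_pi_I (x ξ : ℝ) :
    ‖Complex.exp (2 * Real.pi * Complex.I * (x * ξ))‖ = 1 := by
  rw [show (2 * Real.pi * Complex.I * (x * ξ) : ℂ) = ((2 * Real.pi * (x * ξ) : ℝ) : ℂ) * Complex.I
    by push_cast; ring]
  exact Complex.norm_exp_ofReal_mul_I _

theorem continuous_osc_integrand {p m : ℝ → ℂ} (hp : Continuous p) (hm : Continuous m) (z : ℂ) :
    Continuous fun ξ : ℝ =>
      p ξ * Complex.exp (2 * Real.pi * Complex.I * (z.re * ξ)) * m (z.im * ξ) := by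
  fun_prop

theorem integrable_osc {p m : ℝ → ℂ} (hp : HasMoments p) (hm : Continuous m) {z : ℂ} {N : ℕ}
    {C : ℝ} (hC : ∀ ξ : ℝ, ‖m (z.im * ξ)‖ ≤ C * |ξ| ^ N) : Integrable fun ξ : ℝ =>
      p ξ * Complex.exp (2 * Real.pi * Complex.I * (z.re * ξ)) * m (z.im * ξ) := by
  refine ((hp.integrable N).const_mul C).mono'
    (continuous_osc_integrand hp.continuous hm z).aestronglyMeasurable
    (Eventually.of_forall fun ξ => ?_)
  rw [norm_mul, norm_mul, norm_exp_two_pi_I, mul_one]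
  calc ‖p ξ‖ * ‖m (z.im * ξ)‖ ≤ ‖p ξ‖ * (C * |ξ| ^ N) := by gcongr; exact hC ξ
    _ = _ := by ring

/-- The order of vanishing of `m` at `0` becomes an order of vanishing in `Im z`, at the cost of a
moment of `p`. -/
theorem norm_osc_le {p m : ℝ → ℂ} (hp : HasMoments p) {z : ℂ} {N : ℕ} {C : ℝ}
    (hC : ∀ u : ℝ, ‖m u‖ ≤ C * |u| ^ N) :
    ‖osc p m z‖ ≤ (C * ∫ ξ : ℝ, |ξ| ^ N * ‖p ξ‖) * |z.im| ^ N := by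
  have h : (C * ∫ ξ : ℝ, |ξ| ^ N * ‖p ξ‖) * |z.im| ^ N =
      ∫ ξ : ℝ, (C * |z.im| ^ N) * (|ξ| ^ N * ‖p ξ‖) := by
    rw [integral_const_mul]
    ring
  rw [h]
  refine norm_integral_le_of_norm_le ((hp.integrable N).const_mul _)
    (Eventually.of_forall fun ξ => ?_)
  rw [norm_mul, norm_mul, norm_exp_two_pi_I, mul_one]
  calc ‖p ξ‖ * ‖m (z.im * ξ)‖ ≤ ‖p ξ‖ * (C * |z.im * ξ| ^ N) := by gcongr; exact hC _
    _ = _ := by rw [abs_mul, mul_pow]; ring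

/-- Both partial derivatives are again oscillatory integrals: `∂_x` multiplies `p` by `2πiξ`, while
`∂_y` multiplies `p` by `ξ` and replaces `m` by `m'`. Smoothness then follows by induction. -/
theorem hasFDerivAt_osc {p m : ℝ → ℂ} (hp : HasMoments p) (hm : ContDiff ℝ ∞ m)
    (hc : HasCompactSupport m) (z : ℂ) :
    HasFDerivAt (osc p m)
      (Complex.reCLM.smulRight (osc (fun ξ => 2 * Real.pi * Complex.I * (ξ * p ξ)) m z) +
        Complex.imCLM.smulRight (osc (fun ξ => ξ * p ξ) (deriv m) z)) z := by
  have hm' : ContDiff ℝ ∞ (deriv m) := (contDiff_infty_iff_deriv.1 hm).2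
  obtain ⟨M, hM⟩ := hm.continuous.bounded_above_of_compact_support hc
  obtain ⟨M', hM'⟩ := hm'.continuous.bounded_above_of_compact_support hc.deriv
  have hq₁ : HasMoments fun ξ => 2 * Real.pi * Complex.I * (ξ * p ξ) := hp.id_mul.const_mul _
  have hq₂ : HasMoments fun ξ => ξ * p ξ := hp.id_mul
  have i₁ := integrable_osc (z := z) hq₁ hm.continuous (N := 0) (C := M) fun ξ => by
    simpa using hM _
  have i₂ := integrable_osc (z := z) hq₂ hm'.continuous (N := 0) (C := M') fun ξ => by
    simpa using hM' _
  let L₁ := ContinuousLinearMap.smulRightL ℝ ℂ ℂ Complex.reCLM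
  let L₂ := ContinuousLinearMap.smulRightL ℝ ℂ ℂ Complex.imCLM
  let F' : ℂ → ℝ → ℂ →L[ℝ] ℂ := fun z ξ =>
    L₁ (2 * Real.pi * Complex.I * (ξ * p ξ) *
      Complex.exp (2 * Real.pi * Complex.I * (z.re * ξ)) * m (z.im * ξ)) +
    L₂ (ξ * p ξ * Complex.exp (2 * Real.pi * Complex.I * (z.re * ξ)) * deriv m (z.im * ξ))
  have hF' : ∫ ξ, F' z ξ =
      Complex.reCLM.smulRight (osc (fun ξ => 2 * Real.pi * Complex.I * (ξ * p ξ)) m z) +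
        Complex.imCLM.smulRight (osc (fun ξ => ξ * p ξ) (deriv m) z) := by
    rw [integral_add (L₁.integrable_comp i₁) (L₂.integrable_comp i₂), L₁.integral_comp_comm i₁,
      L₂.integral_comp_comm i₂]
    rfl
  rw [← hF']
  refine hasFDerivAt_integral_of_dominated_of_fderiv_le (𝕜 := ℝ) (s := Set.univ)
    (bound := fun ξ => (2 * Real.pi * M + M') * (|ξ| ^ 1 * ‖p ξ‖)) univ_mem
    (Eventually.of_forall fun w =>
      (continuous_osc_integrand hp.continuous hm.continuous w).aestronglyMeasurable)
    (integrable_osc hp hm.continuous (N := 0) (C := M) fun ξ => by simpa using hM _)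
    ((L₁.integrable_comp i₁).add (L₂.integrable_comp i₂)).aestronglyMeasurable
    (Eventually.of_forall fun ξ w _ => ?_) ((hp.integrable 1).const_mul _)
    (Eventually.of_forall fun ξ w _ => ?_)
  · refine (norm_add_le _ _).trans ?_
    have n₁ : ∀ c, ‖L₁ c‖ ≤ ‖c‖ := fun c => by
      simp [L₁, ContinuousLinearMap.smulRightL]
    have n₂ : ∀ c, ‖L₂ c‖ ≤ ‖c‖ := fun c => by
      simp [L₂, ContinuousLinearMap.smulRightL]
    refine (add_le_add (n₁ _) (n₂ _)).trans ?_
    simp only [norm_mul, norm_exp_two_pi_I, Complex.norm_I, Complex.norm_real, Real.norm_eq_abs,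
      abs_of_pos Real.pi_pos, Complex.norm_ofNat, mul_one, pow_one]
    have hp0 : 0 ≤ |ξ| * ‖p ξ‖ := by positivity
    have := mul_le_mul_of_nonneg_left (hM (w.im * ξ)) hp0
    have := mul_le_mul_of_nonneg_left (hM' (w.im * ξ)) hp0
    nlinarith [Real.pi_pos]
  · have hre : HasFDerivAt (fun w : ℂ => (2 * Real.pi * Complex.I * (w.re * ξ) : ℂ))
        (Complex.reCLM.smulRight (2 * Real.pi * Complex.I * ξ : ℂ)) w := by
      have h := (Complex.reCLM.smulRight (2 * Real.pi * Complex.I * ξ : ℂ)).hasFDerivAt (x := w)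
      convert h using 1
      ext w
      simp
      ring
    have him : HasFDerivAt (fun w : ℂ => w.im * ξ) (ξ • Complex.imCLM) w := by
      have h := (ξ • Complex.imCLM).hasFDerivAt (x := w)
      convert h using 1
      ext w
      simp [mul_comm]
    have hmd : HasDerivAt m (deriv m (w.im * ξ)) (w.im * ξ) :=
      (hm.differentiable (by simp) _).hasDerivAt
    have h := (hre.cexp.const_mul (p ξ)).mul (HasFDerivAt.comp w hmd.hasFDerivAt him)
    refine HasFDerivAt.congr_fderiv h ?_
    ext v
    simp [F', L₁, L₂, ContinuousLinearMap.smulRightL]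
    ring

theorem contDiff_osc {p m : ℝ → ℂ} (hp : HasMoments p) (hm : ContDiff ℝ ∞ m)
    (hc : HasCompactSupport m) : ContDiff ℝ ∞ (osc p m) := by
  rw [contDiff_infty]
  intro n
  induction n generalizing p m with
  | zero =>
    exact contDiff_zero.2 (continuous_iff_continuousAt.2 fun z =>
      (hasFDerivAt_osc hp hm hc z).continuousAt)
  | succ n ih =>
    refine contDiff_succ_iff_hasFDerivAt.2 ⟨_, ?_, hasFDerivAt_osc hp hm hc⟩
    have h₁ := ih (hp.id_mul.const_mul (2 * Real.pi * Complex.I)) hm hc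
    have h₂ := ih hp.id_mul (contDiff_infty_iff_deriv.1 hm).2 hc.deriv
    exact ((ContinuousLinearMap.smulRightL ℝ ℂ ℂ Complex.reCLM).contDiff.comp h₁).add
      ((ContinuousLinearMap.smulRightL ℝ ℂ ℂ Complex.imCLM).contDiff.comp h₂)

/-- For `m(u) = exp(-2πu)` the integrand would be `p(ξ) exp(2πi z ξ)`, holomorphic in `z`; `∂̄` only
sees the defect `m' + 2πm`. -/
theorem dbar_osc {p m : ℝ → ℂ} (hp : HasMoments p) (hm : ContDiff ℝ ∞ m)
    (hc : HasCompactSupport m) (z : ℂ) :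
    dbar (osc p m) z =
      osc (fun ξ => Complex.I / 2 * (ξ * p ξ)) (fun u => deriv m u + 2 * Real.pi * m u) z := by
  have hm' : ContDiff ℝ ∞ (deriv m) := (contDiff_infty_iff_deriv.1 hm).2
  obtain ⟨M, hM⟩ := hm.continuous.bounded_above_of_compact_support hc
  obtain ⟨M', hM'⟩ := hm'.continuous.bounded_above_of_compact_support hc.deriv
  have i₁ := integrable_osc (z := z) (hp.id_mul.const_mul (2 * Real.pi * Complex.I))
    hm.continuous (N := 0) (C := M) fun ξ => by simpa using hM _
  have i₂ := integrable_osc (z := z) hp.id_mul hm'.continuous (N := 0) (C := M') fun ξ => by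
    simpa using hM' _
  rw [dbar, (hasFDerivAt_osc hp hm hc z).fderiv]
  simp only [add_apply, ContinuousLinearMap.smulRight_apply, Complex.reCLM_apply,
    Complex.imCLM_apply, Complex.one_re, Complex.one_im, Complex.I_re, Complex.I_im, one_smul,
    zero_smul, add_zero, zero_add]
  rw [osc, osc, osc, ← integral_const_mul Complex.I, ← integral_add i₁ (i₂.const_mul _),
    ← integral_const_mul]
  congr 1
  ext ξ
  ring

/-- A smooth cutoff of the exponential function `u ↦ exp (-2πu)`. -/
theorem exists_cutoff_exp : ∃ m : ℝ → ℂ, ContDiff ℝ ∞ m ∧ HasCompactSupport m ∧ m 0 = 1 ∧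
    (∀ N : ℕ, ∃ C : ℝ, ∀ u, ‖deriv m u + 2 * Real.pi * m u‖ ≤ C * |u| ^ N) ∧
    ∀ N : ℕ, ∃ C : ℝ, ∀ u : ℝ, ‖m u - ∑ k ∈ Finset.range (N + 1),
      (-(2 * Real.pi * u) : ℂ) ^ k / k.factorial‖ ≤ C * |u| ^ N := by
  obtain ⟨χ, hχ, hχc, hχ1, -, -⟩ := exists_smooth_cutoff ℝ (zero_lt_one)
  let m : ℝ → ℂ := fun u => Complex.exp (-(2 * Real.pi * u)) * χ u
  have hexp : ContDiff ℝ ∞ fun u : ℝ => Complex.exp (-(2 * Real.pi * u)) :=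
    ((contDiff_const.mul Complex.ofRealCLM.contDiff).neg).cexp
  have hm : ContDiff ℝ ∞ m := hexp.mul hχ
  have hmc : HasCompactSupport m := hχc.mul_left
  have hm' : ContDiff ℝ ∞ (deriv m) := (contDiff_infty_iff_deriv.1 hm).2
  obtain ⟨M, hM⟩ := hm.continuous.bounded_above_of_compact_support hmc
  obtain ⟨M', hM'⟩ := hm'.continuous.bounded_above_of_compact_support hmc.deriv
  have hM0 : 0 ≤ M := (norm_nonneg _).trans (hM 0)
  have hM0' : 0 ≤ M' := (norm_nonneg _).trans (hM' 0)
  have hm1 : ∀ u, |u| ≤ 1 → m u = Complex.exp (-(2 * Real.pi * u)) := fun u hu => by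
    simp only [m]
    rw [hχ1 u (by simpa using hu), mul_one]
  -- For `|u| < 1` the defect `m' + 2πm` is zero, and for `|u| ≤ 1` the Taylor remainder of the
  -- exponential is bounded. For larger `|u|` one has `|u|ᴺ ≥ 1`, so crude bounds suffice.
  refine ⟨m, hm, hmc, by simp [hm1 0], fun N => ⟨M' + 2 * Real.pi * M, fun u => ?_⟩,
    fun N => ⟨(2 * Real.pi) ^ (N + 1) * Real.exp (2 * Real.pi) +
      (M + ∑ k ∈ Finset.range (N + 1), (2 * Real.pi) ^ k / k.factorial), fun u => ?_⟩⟩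
  · rcases lt_or_ge |u| 1 with hu | hu
    · have hev : m =ᶠ[𝓝 u] fun u : ℝ => Complex.exp (-(2 * Real.pi * u)) := by
        filter_upwards [(continuous_abs.tendsto u).eventually (gt_mem_nhds hu)] with v hv
        exact hm1 v hv.le
      have hd : HasDerivAt (fun u : ℝ => Complex.exp (-(2 * Real.pi * u)))
          (Complex.exp (-(2 * Real.pi * u)) * (-(2 * Real.pi))) u := by
        have := (((Complex.ofRealCLM.hasDerivAt (x := u)).const_mul
          (2 * Real.pi : ℂ)).neg).cexp
        simpa using this
      rw [hev.deriv_eq, hd.deriv, hm1 u hu.le]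
      ring_nf
      rw [norm_zero]
      positivity
    · calc ‖deriv m u + 2 * Real.pi * m u‖ ≤ ‖deriv m u‖ + ‖2 * Real.pi * m u‖ := norm_add_le _ _
        _ ≤ M' + 2 * Real.pi * M := by
          refine add_le_add (hM' u) ?_
          rw [norm_mul, norm_mul, Complex.norm_ofNat, Complex.norm_real, Real.norm_eq_abs,
            abs_of_pos Real.pi_pos]
          gcongr
          exact hM u
        _ ≤ (M' + 2 * Real.pi * M) * |u| ^ N :=
          le_mul_of_one_le_right (by positivity) (one_le_pow₀ hu)
  · have hn : ‖(-(2 * Real.pi * u) : ℂ)‖ = 2 * Real.pi * |u| := by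
      rw [norm_neg, norm_mul, norm_mul, Complex.norm_ofNat, Complex.norm_real, Complex.norm_real,
        Real.norm_eq_abs, Real.norm_eq_abs, abs_of_pos Real.pi_pos]
    have hS0 : 0 ≤ ∑ k ∈ Finset.range (N + 1), (2 * Real.pi) ^ k / (k.factorial : ℝ) :=
      Finset.sum_nonneg fun k _ => by positivity
    rcases le_or_gt |u| 1 with hu | hu
    · rw [hm1 u hu]
      refine (Complex.norm_exp_sub_sum_le_norm_mul_exp _ _).trans ?_
      rw [hn]
      have h1 : |u| ^ (N + 1) ≤ |u| ^ N := pow_le_pow_of_le_one (abs_nonneg u) hu (Nat.le_succ N)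
      have h2 : 2 * Real.pi * |u| ≤ 2 * Real.pi :=
        mul_le_of_le_one_right (by positivity) hu
      calc (2 * Real.pi * |u|) ^ (N + 1) * Real.exp (2 * Real.pi * |u|)
          ≤ (2 * Real.pi) ^ (N + 1) * |u| ^ N * Real.exp (2 * Real.pi) := by
            rw [mul_pow]
            gcongr
        _ = (2 * Real.pi) ^ (N + 1) * Real.exp (2 * Real.pi) * |u| ^ N := by ring
        _ ≤ _ := by
          gcongr
          linarith
    · have h1 : ∀ k ∈ Finset.range (N + 1), ‖(-(2 * Real.pi * u) : ℂ) ^ k / k.factorial‖ ≤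
          (2 * Real.pi) ^ k / k.factorial * |u| ^ N := by
        intro k hk
        rw [norm_div, norm_pow, hn, mul_pow, Complex.norm_natCast, mul_div_right_comm]
        gcongr
        · exact hu.le
        · exact Nat.lt_succ_iff.1 (Finset.mem_range.1 hk)
      calc _ ≤ ‖m u‖ + ‖∑ k ∈ Finset.range (N + 1), (-(2 * Real.pi * u) : ℂ) ^ k / k.factorial‖ :=
            norm_sub_le _ _
        _ ≤ M * |u| ^ N + ∑ k ∈ Finset.range (N + 1), (2 * Real.pi) ^ k / k.factorial * |u| ^ N :=
            add_le_add ((hM u).trans (le_mul_of_one_le_right hM0 (one_le_pow₀ hu.le)))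
              (norm_sum_le_of_le _ h1)
        _ = (M + ∑ k ∈ Finset.range (N + 1), (2 * Real.pi) ^ k / k.factorial) * |u| ^ N := by
            rw [← Finset.sum_mul]
            ring
        _ ≤ _ := by
          have : 0 ≤ (2 * Real.pi) ^ (N + 1) * Real.exp (2 * Real.pi) := by positivity
          exact mul_le_mul_of_nonneg_right (le_add_of_nonneg_left this) (by positivity)

theorem hasMoments_fourier {f : ℝ → ℂ} (hf : ContDiff ℝ ∞ f) (hc : HasCompactSupport f) :
    HasMoments (𝓕 f : ℝ → ℂ) := by
  let g : SchwartzMap ℝ ℂ := hc.toSchwartzMap hf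
  have h : (𝓕 f : ℝ → ℂ) = ((𝓕 g : SchwartzMap ℝ ℂ) : ℝ → ℂ) := by
    rw [SchwartzMap.fourier_coe]
    rfl
  rw [h]
  exact ⟨SchwartzMap.continuous _, fun n => SchwartzMap.integrable_pow_mul volume _ n⟩

theorem integral_fourier_mul_exp {f : ℝ → ℂ} (hf : ContDiff ℝ ∞ f) (hc : HasCompactSupport f)
    (x : ℝ) : ∫ ξ : ℝ, 𝓕 f ξ * Complex.exp (2 * Real.pi * Complex.I * (x * ξ)) = f x := by
  have hint : Integrable (𝓕 f) := by
    have h := hasMoments_fourier hf hc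
    refine (integrable_norm_iff h.continuous.aestronglyMeasurable).1 ?_
    simpa using h.integrable 0
  have h := congrFun (hf.continuous.fourierInv_fourier_eq
    (hf.continuous.integrable_of_hasCompactSupport hc) hint) x
  rw [Real.fourierInv_eq'] at h
  rw [← h]
  congr 1
  ext ξ
  rw [smul_eq_mul, mul_comm]
  congr 2
  simp
  ring

theorem integral_pow_mul_fourier_mul_exp {f : ℝ → ℂ} (hf : ContDiff ℝ ∞ f)
    (hc : HasCompactSupport f) (x : ℝ) (k : ℕ) :
    ∫ ξ : ℝ, (2 * Real.pi * Complex.I * ξ) ^ k *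
      (𝓕 f ξ * Complex.exp (2 * Real.pi * Complex.I * (x * ξ))) = iteratedDeriv k f x := by
  have hd (n : ℕ) : ContDiff ℝ ∞ (iteratedDeriv n f) := by
    induction n with
    | zero => simpa using hf
    | succ n ih =>
      rw [iteratedDeriv_succ]
      exact (contDiff_infty_iff_deriv.1 ih).2
  have hdc := hasCompactSupport_iteratedDeriv hc
  rw [← integral_fourier_mul_exp (hd k) (hdc k),
    Real.fourier_iteratedDeriv (N := ⊤) hf
      (fun n _ => (hd n).continuous.integrable_of_hasCompactSupport (hdc n)) le_top]
  congr 1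
  ext ξ
  simp only [smul_eq_mul, mul_assoc]

/-- By Fourier inversion the `k`-th Taylor term of `exp(-2πu)` at `u = yξ` contributes `(iy)ᵏ
f⁽ᵏ⁾(x) / k!`. Where all derivatives of order at least one vanish, only `f(x)` survives, and the
difference is the integral of the Taylor remainder. -/
theorem osc_fourier_sub {f m : ℝ → ℂ} (hf : ContDiff ℝ ∞ f) (hc : HasCompactSupport f)
    (hm : ContDiff ℝ ∞ m) (hmc : HasCompactSupport m) (N : ℕ) {z : ℂ}
    (hz : ∀ k ≥ 1, iteratedDeriv k f z.re = 0) :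
    osc (𝓕 f) m z - f z.re = osc (𝓕 f) (fun u => m u - ∑ k ∈ Finset.range (N + 1),
      (-(2 * Real.pi * u) : ℂ) ^ k / k.factorial) z := by
  have hp := hasMoments_fourier hf hc
  obtain ⟨M, hM⟩ := hm.continuous.bounded_above_of_compact_support hmc
  have i₁ := integrable_osc (z := z) hp hm.continuous (N := 0) (C := M) fun ξ => by
    simpa using hM _
  have i₂ (k : ℕ) : Integrable fun ξ : ℝ => 𝓕 f ξ *
      Complex.exp (2 * Real.pi * Complex.I * (z.re * ξ)) *
        ((-(2 * Real.pi * (z.im * ξ : ℝ)) : ℂ) ^ k / k.factorial) := by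
    refine integrable_osc (z := z) (m := fun u => (-(2 * Real.pi * u) : ℂ) ^ k / k.factorial)
      hp (by fun_prop) (N := k) (C := (2 * Real.pi * |z.im|) ^ k) fun ξ => ?_
    rw [norm_div, norm_pow, norm_neg, norm_mul, norm_mul, Complex.norm_ofNat, Complex.norm_real,
      Complex.norm_real, Real.norm_eq_abs, Real.norm_eq_abs, abs_of_pos Real.pi_pos, abs_mul,
      ← mul_assoc, mul_pow, Complex.norm_natCast]
    refine div_le_self (by positivity) ?_
    exact_mod_cast Nat.one_le_iff_ne_zero.2 k.factorial_ne_zero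
  have i₃ (k : ℕ) : ∫ ξ : ℝ, 𝓕 f ξ *
      Complex.exp (2 * Real.pi * Complex.I * (z.re * ξ)) *
        ((-(2 * Real.pi * (z.im * ξ : ℝ)) : ℂ) ^ k / k.factorial) =
      (Complex.I * z.im) ^ k / k.factorial * iteratedDeriv k f z.re := by
    rw [← integral_pow_mul_fourier_mul_exp hf hc, ← integral_const_mul]
    congr 1
    ext ξ
    have : (-(2 * Real.pi * (z.im * ξ : ℝ)) : ℂ) =
        (Complex.I * z.im) * (2 * Real.pi * Complex.I * ξ) := by
      push_cast
      linear_combination (-2 * Real.pi * z.im * ξ : ℂ) * Complex.I_mul_I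
    rw [this, mul_pow]
    ring
  have hsum : f z.re = ∑ k ∈ Finset.range (N + 1), ∫ ξ : ℝ, 𝓕 f ξ *
      Complex.exp (2 * Real.pi * Complex.I * (z.re * ξ)) *
        ((-(2 * Real.pi * (z.im * ξ : ℝ)) : ℂ) ^ k / k.factorial) := by
    rw [Finset.sum_eq_single_of_mem 0 (by simp) fun k _ hk => by
      rw [i₃, hz k (Nat.one_le_iff_ne_zero.2 hk), mul_zero], i₃]
    simp
  rw [hsum, ← integral_finsetSum _ fun k _ => i₂ k, osc, osc,
    ← integral_sub i₁ (integrable_finsetSum _ fun k _ => i₂ k)]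
  congr 1
  ext ξ
  rw [mul_sub, Finset.mul_sum]

theorem iteratedDeriv_eq_zero_of_notMem_tsupport {f : ℝ → ℂ} {x : ℝ} (hx : x ∉ tsupport f)
    (k : ℕ) : iteratedDeriv k f x = 0 := by
  rw [(notMem_tsupport_iff_eventuallyEq.1 hx).iteratedDeriv_eq k]
  change iteratedDeriv k (fun _ => (0 : ℂ)) x = 0
  rw [iteratedDeriv_const]
  simp

/-- Every test function has an almost holomorphic extension, which moreover is locally constant
to infinite order wherever the test function is. -/
theorem exists_isAlmostHolExtension (φ : TestFn) : ∃ F : ℂ → ℂ, IsAlmostHolExtension φ F ∧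
    ∀ N : ℕ, ∃ C : ℝ, ∀ z : ℂ, (∀ k ≥ 1, iteratedDeriv k φ z.re = 0) →
      ‖F z - φ z.re‖ ≤ C * |z.im| ^ N := by
  obtain ⟨m, hm, hmc, hm0, hmd, hmt⟩ := exists_cutoff_exp
  have hp := hasMoments_fourier φ.smooth φ.hasCompactSupport
  let F₀ : ℂ → ℂ := osc (𝓕 (φ : ℝ → ℂ)) m
  have hF₀ : ContDiff ℝ ∞ F₀ := contDiff_osc hp hm hmc
  have hF₀x : ∀ x : ℝ, F₀ x = φ x := by
    intro x
    simp only [F₀, osc, Complex.ofReal_re, Complex.ofReal_im, zero_mul, hm0, mul_one]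
    exact integral_fourier_mul_exp φ.smooth φ.hasCompactSupport x
  have hF₀b : ∃ M, 0 ≤ M ∧ ∀ z, ‖F₀ z‖ ≤ M := by
    obtain ⟨M, hM⟩ := hm.continuous.bounded_above_of_compact_support hmc
    refine ⟨_, ?_, fun z => by
      simpa using norm_osc_le hp (z := z) (N := 0) (C := M) fun u => by simpa using hM u⟩
    have : 0 ≤ M := (norm_nonneg _).trans (hM 0)
    positivity
  have hF₀d : ∀ N : ℕ, ∃ C : ℝ, ∀ z, ‖dbar F₀ z‖ ≤ C * |z.im| ^ N := by
    intro N
    obtain ⟨C, hC⟩ := hmd N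
    exact ⟨_, fun z => (congrArg norm (dbar_osc hp hm hmc z)).trans_le
      (norm_osc_le (hp.id_mul.const_mul _) hC)⟩
  have hF₀t : ∀ N : ℕ, ∃ C : ℝ, ∀ z : ℂ, (∀ k ≥ 1, iteratedDeriv k φ z.re = 0) →
      ‖F₀ z - φ z.re‖ ≤ C * |z.im| ^ N := by
    intro N
    obtain ⟨C, hC⟩ := hmt N
    exact ⟨_, fun z hz => (congrArg norm
      (osc_fourier_sub φ.smooth φ.hasCompactSupport hm hmc N hz)).trans_le (norm_osc_le hp hC)⟩
  obtain ⟨M₀, hM₀0, hM₀⟩ := hF₀b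
  obtain ⟨M₁, hM₁⟩ := φ.continuous.bounded_above_of_compact_support φ.hasCompactSupport
  have hM₁0 : 0 ≤ M₁ := (norm_nonneg _).trans (hM₁ 0)
  obtain ⟨ρ, hρ⟩ := φ.hasCompactSupport.isCompact.isBounded.subset_closedBall 0
  have hr : 0 < |ρ| + 2 := by positivity
  obtain ⟨η, hη, hηc, hη1, -, hηb⟩ := exists_smooth_cutoff ℂ hr
  have hηd : ContDiff ℝ 1 η := hη.of_le (by simp)
  obtain ⟨M₂, hM₂⟩ := (continuous_dbar hηd).bounded_above_of_compact_support
    (hasCompactSupport_dbar hηc)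
  have hM₂0 : 0 ≤ M₂ := (norm_nonneg _).trans (hM₂ 0)
  have hfar : ∀ z : ℂ, |ρ| + 2 ≤ ‖z‖ → |z.im| ≤ 1 → z.re ∉ tsupport φ := by
    intro z hz hy hmem
    have h1 := hρ hmem
    rw [Metric.mem_closedBall, dist_zero_right, Real.norm_eq_abs] at h1
    have h2 := Complex.norm_le_abs_re_add_abs_im z
    linarith [le_abs_self ρ]
  -- Outside the disc `F₀` is itself flat, so the term `∂̄η · F₀` created by the cutoff `η` is
  -- harmless. Either `|Im z| ≤ 1` and `Re z` misses the support of `φ`, or `|Im z| > 1` and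
  -- boundedness suffices.
  have hF₀s : ∀ N : ℕ, ∃ C : ℝ, 0 ≤ C ∧ ∀ z : ℂ, |ρ| + 2 ≤ ‖z‖ → ‖F₀ z‖ ≤ C * |z.im| ^ N ∧
      ‖φ z.re‖ ≤ C * |z.im| ^ N := by
    intro N
    obtain ⟨C, hC⟩ := hF₀t N
    refine ⟨|C| + M₀ + M₁, by positivity, fun z hz => ?_⟩
    rcases le_or_gt |z.im| 1 with hy | hy
    · have hx := hfar z hz hy
      have h0 : φ z.re = 0 := image_eq_zero_of_notMem_tsupport hx
      have := hC z fun k _ => iteratedDeriv_eq_zero_of_notMem_tsupport hx k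
      rw [h0, sub_zero] at this
      rw [h0, norm_zero]
      refine ⟨this.trans ?_, by positivity⟩
      gcongr
      linarith [le_abs_self C]
    · have h1 : 1 ≤ |z.im| ^ N := one_le_pow₀ hy.le
      have h2 := le_mul_of_one_le_right (by positivity : 0 ≤ |C| + M₀ + M₁) h1
      have h3 := abs_nonneg C
      exact ⟨by linarith [hM₀ z], by linarith [hM₁ z.re]⟩
  refine ⟨fun z => η z * F₀ z, ⟨hη.mul hF₀, hηc.mul_right, fun x => ?_, fun N => ?_⟩, fun N => ?_⟩
  · rcases le_or_gt ‖(x : ℂ)‖ (|ρ| + 2) with h | h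
    · rw [hη1 _ h, one_mul, hF₀x]
    · have : φ x = 0 := image_eq_zero_of_notMem_tsupport (hfar x h.le (by simp))
      rw [hF₀x, this, mul_zero]
  · obtain ⟨C₁, hC₁⟩ := hF₀d N
    obtain ⟨C₂, hC₂0, hC₂⟩ := hF₀s N
    refine ⟨C₁ + C₂ * M₂, fun z => ?_⟩
    rw [dbar_mul (hη.differentiable (by simp) z) (hF₀.differentiable (by simp) z), add_mul]
    refine (norm_add_le _ _).trans (add_le_add ?_ ?_)
    · rw [norm_mul]
      exact (mul_le_of_le_one_left (norm_nonneg _) (hηb z)).trans (hC₁ z)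
    · rw [norm_mul]
      rcases lt_or_ge ‖z‖ (|ρ| + 2) with h | h
      · have hev : η =ᶠ[𝓝 z] fun _ => 1 := by
          filter_upwards [(continuous_norm.tendsto z).eventually (gt_mem_nhds h)] with w hw
          exact hη1 w hw.le
        rw [dbar_congr hev, dbar_eq_zero_of_differentiableAt (differentiableAt_const _), norm_zero,
          zero_mul]
        positivity
      · calc ‖dbar η z‖ * ‖F₀ z‖ ≤ M₂ * (C₂ * |z.im| ^ N) :=
              mul_le_mul (hM₂ z) (hC₂ z h).1 (norm_nonneg _) hM₂0
          _ = _ := by ring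
  · obtain ⟨C₁, hC₁⟩ := hF₀t N
    obtain ⟨C₂, hC₂0, hC₂⟩ := hF₀s N
    refine ⟨|C₁| + (C₂ + C₂), fun z hz => ?_⟩
    have hpow : 0 ≤ |z.im| ^ N := by positivity
    rcases le_or_gt ‖z‖ (|ρ| + 2) with h | h
    · dsimp only
      rw [hη1 z h, one_mul]
      refine (hC₁ z hz).trans ?_
      gcongr
      linarith [le_abs_self C₁]
    · calc ‖η z * F₀ z - φ z.re‖ ≤ ‖η z * F₀ z‖ + ‖φ z.re‖ := norm_sub_le _ _
        _ ≤ ‖F₀ z‖ + ‖φ z.re‖ := by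
          rw [norm_mul]
          gcongr
          exact mul_le_of_le_one_left (norm_nonneg _) (hηb z)
        _ ≤ C₂ * |z.im| ^ N + C₂ * |z.im| ^ N := add_le_add (hC₂ z h.le).1 (hC₂ z h.le).2
        _ ≤ _ := by
          rw [← add_mul]
          exact mul_le_mul_of_nonneg_right (le_add_of_nonneg_left (abs_nonneg C₁)) hpow

/-- There are almost holomorphic cutoff functions which are `1` on a given disc. -/
theorem exists_isAlmostHolExtension_cutoff {ρ : ℝ} (hρ : 0 < ρ) : ∃ (θ : TestFn) (Θ : ℂ → ℂ),
    IsAlmostHolExtension θ Θ ∧ ∀ z, ‖z‖ ≤ ρ → Θ z = 1 := by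
  obtain ⟨χ, hχ, hχc, hχ1, -, -⟩ := exists_smooth_cutoff ℝ (by linarith : 0 < ρ + 2)
  obtain ⟨η, hη, hηc, hη1, hη0, hηb⟩ := exists_smooth_cutoff ℂ hρ
  let θ : TestFn := TestFn.of χ hχ hχc
  obtain ⟨Θ, hΘ, hΘt⟩ := exists_isAlmostHolExtension θ
  have hηd : ContDiff ℝ 1 η := hη.of_le (by simp)
  obtain ⟨M, hM⟩ := (continuous_dbar hηd).bounded_above_of_compact_support
    (hasCompactSupport_dbar hηc)
  have hM0 : 0 ≤ M := (norm_nonneg _).trans (hM 0)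
  have hdη : ∀ z, ρ + 1 < ‖z‖ → dbar η z = 0 := by
    intro z hz
    have hev : η =ᶠ[𝓝 z] fun _ => 0 := by
      filter_upwards [(continuous_norm.tendsto z).eventually (lt_mem_nhds hz)] with w hw
      exact hη0 w hw.le
    rw [dbar_congr hev, dbar_eq_zero_of_differentiableAt (differentiableAt_const _)]
  have hθ1 : ∀ x : ℝ, |x| ≤ ρ + 1 → θ x = 1 ∧ ∀ k ≥ 1, iteratedDeriv k θ x = 0 := by
    intro x hx
    have hev : (θ : ℝ → ℂ) =ᶠ[𝓝 x] fun _ => 1 := by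
      filter_upwards [(continuous_abs.tendsto x).eventually
        (gt_mem_nhds (by linarith : |x| < ρ + 2))] with w hw
      exact hχ1 w hw.le
    refine ⟨hev.self_of_nhds, fun k hk => ?_⟩
    rw [hev.iteratedDeriv_eq k, iteratedDeriv_const, if_neg (by omega)]
  -- Gluing `η` and `Θ` as `1 - (1 - η)(1 - Θ)` gives the value `1` wherever `η = 1`. Its `∂̄` is
  -- `(1 - η) ∂̄Θ + ∂̄η (1 - Θ)`; the last term is flat because `∂̄η` vanishes for `‖z‖ > ρ + 1`,
  -- while `1 - Θ` is flat over `|Re z| ≤ ρ + 1`, where `θ` is locally `1`.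
  have hd : ContDiff ℝ ∞ fun z => 1 - (1 - η z) * (1 - Θ z) :=
    contDiff_const.sub ((contDiff_const.sub hη).mul (contDiff_const.sub hΘ.contDiff))
  refine ⟨θ, fun z => 1 - (1 - η z) * (1 - Θ z), ⟨hd, ?_, fun x => ?_, fun N => ?_⟩, fun z hz => ?_⟩
  · have : (fun z => 1 - (1 - η z) * (1 - Θ z)) = fun z => η z + (1 - η z) * Θ z := by
      ext z
      ring
    rw [this]
    exact hηc.add hΘ.hasCompactSupport.mul_left
  · rw [hΘ.extends_fn]
    rcases le_or_gt |x| (ρ + 1) with h | h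
    · rw [(hθ1 x h).1]
      ring
    · rw [hη0 x (by simpa using h.le)]
      ring
  · obtain ⟨C₁, hC₁⟩ := hΘ.dbar_bound N
    obtain ⟨C₂, hC₂⟩ := hΘt N
    refine ⟨2 * C₁ + M * |C₂|, fun z => ?_⟩
    have h1 : DifferentiableAt ℝ (fun z => 1 - η z) z :=
      (hη.differentiable (by simp) z).const_sub 1
    have h2 : DifferentiableAt ℝ (fun z => 1 - Θ z) z :=
      (hΘ.contDiff.differentiable (by simp) z).const_sub 1
    rw [dbar_const_sub, norm_neg, dbar_mul h1 h2, dbar_const_sub, dbar_const_sub, add_mul]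
    refine (norm_add_le _ _).trans (add_le_add ?_ ?_)
    · rw [norm_mul, norm_neg, mul_assoc]
      have h3 : ‖1 - η z‖ ≤ 2 := by
        refine (norm_sub_le _ _).trans ?_
        rw [norm_one]
        linarith [hηb z]
      exact mul_le_mul h3 (hC₁ z) (norm_nonneg _) zero_le_two
    · rw [norm_mul, norm_neg]
      rcases le_or_gt ‖z‖ (ρ + 1) with h | h
      · obtain ⟨h4, h5⟩ := hθ1 z.re ((Complex.abs_re_le_norm z).trans h)
        have h6 := hC₂ z h5
        rw [h4, norm_sub_rev] at h6
        calc ‖dbar η z‖ * ‖1 - Θ z‖ ≤ M * (|C₂| * |z.im| ^ N) := by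
              gcongr
              · exact hM z
              · exact h6.trans (by gcongr; exact le_abs_self C₂)
          _ = _ := by ring
      · rw [hdη z h, norm_zero, zero_mul]
        positivity
  · dsimp only
    rw [hη1 z hz]
    ring

variable {X : Type*} [NormedAddCommGroup X] [NormedSpace ℂ X]

/-! ### The integral formula on the ranges of a hyperoperator -/

/-- Density of the union of the ranges reduces `A = [a]`, as well as the linearity and
multiplicativity of the extension, to identities among the `A φ`. -/
theorem IsHyperoperator.ext {A : TestFn →L[ℂ] (X →L[ℂ] X)} (hA : IsHyperoperator A)
    {S T : X →L[ℂ] X} (h : ∀ φ, S.comp (A φ) = T.comp (A φ)) : S = T := by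
  refine DFunLike.coe_injective (Continuous.ext_on hA.dense_range S.continuous T.continuous ?_)
  intro y hy
  obtain ⟨φ, x, rfl⟩ := Set.mem_iUnion.1 hy
  exact congrArg (fun U : X →L[ℂ] X => U x) (h φ)

theorem IsAlmostHolExtension.isFlat {φ : TestFn} {F : ℂ → ℂ} (hF : IsAlmostHolExtension φ F) :
    IsFlat (dbar F) :=
  ⟨continuous_dbar (hF.contDiff.of_le (by simp)), hasCompactSupport_dbar hF.hasCompactSupport,
    hF.dbar_bound⟩

/-- Composition with `A φ` turns `R z` into `A (φ / (z - ·))`; `A` then leaves the integral, and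
Cauchy-Pompeiu gives `φ(t) ∫ ∂̄Ψ(z) / (z - t) = π φ(t) (c - Ψ(t))`. Allowing `c ≠ 0` covers
functions that do not vanish at infinity. -/
theorem cauchyIntegral_comp [CompleteSpace X] (A : TestFn →L[ℂ] (X →L[ℂ] X))
    {R : ℂ → X →L[ℂ] X}
    (hR : ∀ z : ℂ, z.im ≠ 0 → ∀ φ : TestFn, (R z).comp (A φ) = A (φ.divSub z))
    {Ψ : ℂ → ℂ} (hΨ : ContDiff ℝ 1 Ψ) (hflat : IsFlat (dbar Ψ)) {c : ℂ}
    (hlim : Tendsto Ψ (cocompact ℂ) (𝓝 c)) (hint : Integrable fun z => dbar Ψ z • R z)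
    (φ χ : TestFn) (hχ : ∀ t : ℝ, χ t = φ t * (Ψ t - c)) :
    ((-(1 / Real.pi : ℂ)) • ∫ z : ℂ, dbar Ψ z • R z).comp (A φ) = A χ := by
  let L : (X →L[ℂ] X) →L[ℂ] (X →L[ℂ] X) := (ContinuousLinearMap.compL ℂ X X X).flip (A φ)
  have hL : ∀ S, L S = S.comp (A φ) := fun S => rfl
  have hae : (fun z => L (dbar Ψ z • R z)) =ᵐ[volume] fun z => dbar Ψ z • A (φ.divSub z) := by
    filter_upwards [ae_im_ne_zero] with z hz
    rw [map_smul, hL, hR z hz]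
  have hpi : (Real.pi : ℂ) ≠ 0 := by exact_mod_cast Real.pi_ne_zero
  have h := map_cauchyIntegral A hflat φ (-(Real.pi : ℂ) • χ) (fun t => by
    rw [smul_apply, smul_eq_mul, integral_dbar_div hΨ hflat.hasCompactSupport hlim, hχ]
    ring) ((L.integrable_comp hint).congr hae)
  rw [← hL, map_smul, ← L.integral_comp_comm hint, integral_congr_ae hae, ← h, map_smul, smul_smul,
    neg_mul_neg, one_div_mul_cancel hpi, one_smul]

/-! ### The resolvent of a Helffer-Sjöstrand operator -/

theorem IsResolventAt.sub_eq {a : X →ₗ.[ℂ] X} {z w : ℂ} {S T : X →L[ℂ] X}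
    (hS : IsResolventAt a z S) (hT : IsResolventAt a w T) : T - S = (z - w) • S.comp T := by
  ext y
  obtain ⟨x, hx, hxy⟩ := hT.2 y
  have h1 : y = (z • (x : X) - a x) + (w - z) • (x : X) := by
    rw [← hxy, sub_smul]
    abel
  have h2 : S y = x + (w - z) • S x := by
    conv_lhs => rw [h1]
    rw [map_add, map_smul, hS.1 x]
  simp only [sub_apply, smul_apply, ContinuousLinearMap.comp_apply]
  rw [h2, ← hx, ← neg_sub w z, neg_smul]
  abel

theorem IsHSOperator.isResolventAt {a : X →ₗ.[ℂ] X} (ha : IsHSOperator a) {z : ℂ}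
    (hz : z.im ≠ 0) : IsResolventAt a z (pmapResolvent a z) :=
  isResolventAt_pmapResolvent (not_not.1 fun h => hz (ha.real_spectrum z h))

theorem IsHSOperator.continuousOn_resolvent {a : X →ₗ.[ℂ] X} (ha : IsHSOperator a) :
    ContinuousOn (pmapResolvent a) {z | z.im ≠ 0} := by
  refine continuousOn_of_resolvent_identity (fun z hz w hw => ?_) fun z hz => ?_
  · have h := (ha.isResolventAt hw).sub_eq (ha.isResolventAt hz)
    rw [← neg_sub, h, ← neg_smul, neg_sub]
    rfl
  · obtain ⟨N, C, h⟩ := ha.resolvent_bound _ (isCompact_closedBall z 1)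
    refine ⟨|C| * (1 / (|z.im| / 2)) ^ N, ?_⟩
    filter_upwards [self_mem_nhdsWithin, (eventually_im_ge hz).filter_mono nhdsWithin_le_nhds,
      mem_nhdsWithin_of_mem_nhds (Metric.closedBall_mem_nhds z one_pos)] with w hw hw' hwb
    have : 0 < |z.im| := abs_pos.2 hz
    refine (h w hwb hw).trans ?_
    gcongr
    exact le_abs_self C

theorem IsHSOperator.integrable_smul {a : X →ₗ.[ℂ] X} (ha : IsHSOperator a) {κ : ℂ → ℂ}
    (hκ : IsFlat κ) : Integrable fun z => κ z • pmapResolvent a z := by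
  obtain ⟨N, C, h⟩ := ha.resolvent_bound _ hκ.hasCompactSupport
  exact hκ.integrable_smul_of_bound ha.continuousOn_resolvent h

/-! ### The resolvent functions in `𝒢(ℝ)` -/

/-- In the coordinate `w = 1 / t` the function is `w / (zw - 1)`; its only possible pole `1 / z`
lies outside the open disc because `r ‖z‖ ≤ 1`. -/
theorem isHolNearInfty_cauchy {z : ℂ} {r : ℝ} (hr : r * ‖z‖ ≤ 1) :
    IsHolNearInfty (fun p : OnePoint ℝ => p.elim 0 fun t : ℝ => (z - t)⁻¹) r
      (fun w => w * (z * w - 1)⁻¹) := by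
  refine ⟨?_, by simp, fun t ht htr => ?_⟩
  · refine differentiableOn_id.mul (DifferentiableOn.inv (by fun_prop) fun w hw h => ?_)
    have hw' : ‖w‖ < r := by simpa using hw
    have h1 : ‖z‖ * ‖w‖ = 1 := by
      rw [← norm_mul, sub_eq_zero.1 h, norm_one]
    have hz : 0 < ‖z‖ := by
      rcases (norm_nonneg z).eq_or_lt with h0 | h0
      · rw [← h0, zero_mul] at h1
        exact absurd h1 zero_ne_one
      · exact h0
    nlinarith
  · change _ = (z - ((t⁻¹ : ℝ) : ℂ))⁻¹
    have ht' : (t : ℂ) ≠ 0 := by exact_mod_cast ht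
    rw [Complex.ofReal_inv, show z - (t : ℂ)⁻¹ = (z * t - 1) / t by field_simp, inv_div,
      div_eq_mul_inv]

open Classical in
/-- The function `t ↦ (z - t)⁻¹`, for `z ∉ ℝ`, as an element of `𝒢(ℝ)`. -/
def cauchyG (z : ℂ) : G :=
  if hz : z.im ≠ 0 then
    ⟨fun p => p.elim 0 fun t : ℝ => (z - t)⁻¹,
      ContDiff.inv (contDiff_const.sub Complex.ofRealCLM.contDiff) (sub_ofReal_ne_zero hz),
      (‖z‖ + 1)⁻¹, by positivity, _, isHolNearInfty_cauchy (by
        rw [inv_mul_le_iff₀ (by positivity)]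
        linarith)⟩
  else 0

theorem cauchyG_coe {z : ℂ} (hz : z.im ≠ 0) (t : ℝ) :
    (cauchyG z : OnePoint ℝ → ℂ) (t : OnePoint ℝ) = (z - t)⁻¹ := by
  rw [cauchyG, dif_pos hz]
  rfl

theorem cauchyG_infty {z : ℂ} (hz : z.im ≠ 0) :
    (cauchyG z : OnePoint ℝ → ℂ) OnePoint.infty = 0 := by
  rw [cauchyG, dif_pos hz]
  rfl

theorem isHolNearInfty_cauchyG {z : ℂ} (hz : z.im ≠ 0) {r : ℝ} (hr : r * ‖z‖ ≤ 1) :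
    IsHolNearInfty (cauchyG z : OnePoint ℝ → ℂ) r (fun w => w * (z * w - 1)⁻¹) := by
  rw [cauchyG, dif_pos hz]
  exact isHolNearInfty_cauchy hr

theorem G_ext {f g : G} (h : ∀ t : ℝ, (f : OnePoint ℝ → ℂ) (t : OnePoint ℝ) =
    (g : OnePoint ℝ → ℂ) (t : OnePoint ℝ))
    (h' : (f : OnePoint ℝ → ℂ) OnePoint.infty = (g : OnePoint ℝ → ℂ) OnePoint.infty) : f = g := by
  apply Subtype.ext
  funext p
  induction p using OnePoint.rec with
  | infty => exact h'
  | coe t => exact h t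

@[simp]
theorem toG_coe (φ : TestFn) (t : ℝ) : (φ.toG : OnePoint ℝ → ℂ) (t : OnePoint ℝ) = φ t := rfl

@[simp]
theorem toG_infty (φ : TestFn) : (φ.toG : OnePoint ℝ → ℂ) OnePoint.infty = 0 := rfl

theorem cauchyG_sub {z w : ℂ} (hz : z.im ≠ 0) (hw : w.im ≠ 0) :
    cauchyG w - cauchyG z = (z - w) • (cauchyG w * cauchyG z) := by
  refine G_ext (fun t => ?_) ?_
  · have h1 := sub_ofReal_ne_zero hz t
    have h2 := sub_ofReal_ne_zero hw t
    simp [cauchyG_coe hz, cauchyG_coe hw]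
    field_simp
    ring
  · simp [cauchyG_infty hz, cauchyG_infty hw]

theorem cauchyG_mul_toG {z : ℂ} (hz : z.im ≠ 0) (φ : TestFn) :
    cauchyG z * φ.toG = (φ.divSub z).toG := by
  refine G_ext (fun t => ?_) ?_
  · simp [cauchyG_coe hz, TestFn.divSub_apply φ hz, mul_comm]
  · simp [cauchyG_infty hz]

theorem iteratedDeriv_inv_sub_ofReal {z : ℂ} (hz : z.im ≠ 0) (k : ℕ) :
    iteratedDeriv k (fun t : ℝ => (z - t)⁻¹) =
      fun t : ℝ => (k.factorial : ℂ) * ((z - t)⁻¹) ^ (k + 1) := by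
  induction k with
  | zero => simp
  | succ k ih =>
    rw [iteratedDeriv_succ, ih]
    ext t
    have hne := sub_ofReal_ne_zero hz t
    have h2 : HasDerivAt (fun t : ℝ => z - (t : ℂ)) (-1) t := by
      simpa using (Complex.ofRealCLM.hasDerivAt (x := t)).const_sub z
    refine (((h2.inv hne).pow (k + 1)).const_mul (k.factorial : ℂ)).deriv.trans ?_
    simp [Nat.factorial_succ]
    field_simp
    ring

/-- The resolvent functions have polynomially bounded images under a continuous linear map on
`𝒢(ℝ)`. -/
theorem exists_bound_cauchyG (B : G →ₗ[ℂ] (X →L[ℂ] X)) (hB : IsContinuousOnG B) {K : Set ℂ}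
    (hK : IsCompact K) : ∃ (N : ℕ) (C : ℝ), ∀ z ∈ K, z.im ≠ 0 →
      ‖B (cauchyG z)‖ ≤ C * (1 / |z.im|) ^ N := by
  by_contra! h
  obtain ⟨M₀, hM₀⟩ := hK.isBounded.exists_norm_le
  set M : ℝ := max M₀ 1
  have hM1 : 1 ≤ M := le_max_right _ _
  have hM0 : 0 < M := by linarith
  -- If no power works, `z n` violates the bound with exponent `n` and constant `(n + 1) Mⁿ`.
  -- Scaling by `c n`, the reciprocal of that bound, gives images of norm at least one. Yet the
  -- scaled functions tend to `0` in `𝒢(ℝ)`: for `n ≥ k + 1` the factor `|Im z|ⁿ` absorbs the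
  -- singularity `|Im z|⁻ᵏ⁻¹` of the `k`-th derivative, and `1 / (n + 1)` supplies the decay.
  choose z hzK hz hzB using fun n : ℕ => h n ((n + 1) * M ^ n)
  have hzM : ∀ n, ‖z n‖ ≤ M := fun n => (hM₀ _ (hzK n)).trans (le_max_left _ _)
  have him : ∀ n, 0 < |(z n).im| := fun n => abs_pos.2 (hz n)
  have himM : ∀ n, |(z n).im| / M ≤ 1 := fun n =>
    (div_le_one hM0).2 ((Complex.abs_im_le_norm _).trans (hzM n))
  let c : ℕ → ℝ := fun n => (|(z n).im| / M) ^ n / (n + 1)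
  have hc0 : ∀ n, 0 ≤ c n := fun n => by positivity
  have hc1 : ∀ n, c n ≤ 1 / ((n : ℝ) + 1) := fun n => by
    have : (|(z n).im| / M) ^ n ≤ 1 := pow_le_one₀ (by positivity) (himM n)
    simp only [c]
    gcongr
  let u : ℕ → G := fun n => (c n : ℂ) • cauchyG (z n)
  have hu : ∀ n t, (u n : OnePoint ℝ → ℂ) ((t : ℝ) : OnePoint ℝ) = c n * (z n - t)⁻¹ := by
    intro n t
    simp [u, cauchyG_coe (hz n)]
  have hone : Tendsto (fun n : ℕ => 1 / ((n : ℝ) + 1)) atTop (𝓝 0) :=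
    tendsto_one_div_add_atTop_nhds_zero_nat
  have htend : TendstoG u 0 := by
    -- The radius `1 / (2M)` forces `|z n * w| ≤ 1 / 2` for all `n`, so one disc stays uniformly
    -- away from all the poles.
    refine ⟨fun k => ?_, 1 / (2 * M), by positivity,
      fun n w => c n * (w * (z n * w - 1)⁻¹), fun _ => 0, fun n => ?_, ?_, ?_⟩
    · refine TendstoUniformly.tendstoLocallyUniformly ?_
      rw [Metric.tendstoUniformly_iff]
      intro ε hε
      have hk : Tendsto (fun n : ℕ => k.factorial * (1 / ((n : ℝ) + 1))) atTop (𝓝 0) := by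
        simpa using hone.const_mul (k.factorial : ℝ)
      filter_upwards [hk.eventually (gt_mem_nhds hε), eventually_ge_atTop (k + 1)] with n hn hkn t
      have h0 : iteratedDeriv k (fun x : ℝ => ((0 : G) : OnePoint ℝ → ℂ) (x : OnePoint ℝ)) t =
          0 := by
        change iteratedDeriv k (fun _ => (0 : ℂ)) t = 0
        rw [iteratedDeriv_const]
        simp
      rw [h0, dist_zero_left, funext (hu n), iteratedDeriv_const_mul_field,
        iteratedDeriv_inv_sub_ofReal (hz n), norm_mul, norm_mul, norm_pow, Complex.norm_natCast,
        Complex.norm_real, Real.norm_of_nonneg (hc0 n)]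
      refine lt_of_le_of_lt ?_ hn
      have h1 : ‖(z n - t)⁻¹‖ ^ (k + 1) ≤ (1 / |(z n).im|) ^ (k + 1) :=
        pow_le_pow_left₀ (norm_nonneg _) (norm_inv_sub_ofReal_le (hz n) t) _
      have h2 : (|(z n).im| / M) ^ n * (1 / |(z n).im|) ^ (k + 1) ≤ 1 := by
        calc (|(z n).im| / M) ^ n * (1 / |(z n).im|) ^ (k + 1)
            ≤ (|(z n).im| / M) ^ (k + 1) * (1 / |(z n).im|) ^ (k + 1) := by
              gcongr ?_ * _
              exact pow_le_pow_of_le_one (by positivity) (himM n) hkn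
          _ = (1 / M) ^ (k + 1) := by
              rw [← mul_pow]
              congr 1
              have := (him n).ne'
              field_simp
          _ ≤ 1 := pow_le_one₀ (by positivity) ((div_le_one hM0).2 hM1)
      calc c n * (k.factorial * ‖(z n - t)⁻¹‖ ^ (k + 1))
          ≤ c n * (k.factorial * (1 / |(z n).im|) ^ (k + 1)) := by
            gcongr
        _ = k.factorial * (((|(z n).im| / M) ^ n * (1 / |(z n).im|) ^ (k + 1)) / (n + 1)) := by
            simp only [c]
            ring
        _ ≤ k.factorial * (1 / ((n : ℝ) + 1)) := by gcongr
    · have hr : 1 / (2 * M) * ‖z n‖ ≤ 1 := by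
        rw [one_div_mul_eq_div, div_le_one (by positivity)]
        linarith [hzM n]
      have h1 := isHolNearInfty_cauchyG (hz n) hr
      refine ⟨h1.1.const_mul _, ?_, fun t ht htr => ?_⟩
      · change _ = (c n : ℂ) * (cauchyG (z n) : OnePoint ℝ → ℂ) OnePoint.infty
        rw [← h1.2]
      · change _ = (c n : ℂ) * (cauchyG (z n) : OnePoint ℝ → ℂ) _
        rw [← h1.3 t ht htr]
    · exact ⟨differentiableOn_const _, rfl, fun _ _ _ => rfl⟩
    · refine TendstoUniformlyOn.tendstoLocallyUniformlyOn ?_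
      rw [Metric.tendstoUniformlyOn_iff]
      intro ε hε
      filter_upwards [hone.eventually (gt_mem_nhds hε)] with n hn w hw
      have hw' : ‖w‖ < 1 / (2 * M) := by simpa using hw
      have hw1 : ‖w‖ ≤ 1 / 2 := hw'.le.trans (by
        rw [div_le_div_iff₀ (by positivity) (by positivity)]
        linarith)
      have h1 : ‖z n * w‖ ≤ 1 / 2 := by
        rw [norm_mul]
        calc ‖z n‖ * ‖w‖ ≤ M * (1 / (2 * M)) := by gcongr; exact hzM n
          _ = 1 / 2 := by field_simp
      have h2 : 1 / 2 ≤ ‖z n * w - 1‖ := by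
        have := norm_sub_norm_le (1 : ℂ) (z n * w)
        rw [norm_one, norm_sub_rev] at this
        linarith
      have h3 : ‖w * (z n * w - 1)⁻¹‖ ≤ 1 := by
        rw [norm_mul, norm_inv, ← div_eq_mul_inv, div_le_one (by linarith)]
        linarith
      rw [dist_zero_left, norm_mul, Complex.norm_real, Real.norm_of_nonneg (hc0 n)]
      calc c n * ‖w * (z n * w - 1)⁻¹‖ ≤ c n * 1 := by gcongr
        _ ≤ 1 / ((n : ℝ) + 1) := by rw [mul_one]; exact hc1 n
        _ < ε := hn
  have hlim := (hB u 0 htend).norm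
  rw [map_zero, norm_zero] at hlim
  obtain ⟨n, hn⟩ := (hlim.eventually (gt_mem_nhds (zero_lt_one))).exists
  refine absurd hn (not_lt.2 ?_)
  simp only [u]
  rw [map_smul, norm_smul, Complex.norm_real, Real.norm_of_nonneg (hc0 n)]
  calc (1 : ℝ) = c n * ((n + 1) * M ^ n * (1 / |(z n).im|) ^ n) := by
        have h1 := (him n).ne'
        have h2 : (n : ℝ) + 1 ≠ 0 := by positivity
        simp only [c]
        rw [div_pow, one_div, inv_pow]
        field_simp
    _ ≤ c n * ‖B (cauchyG (z n))‖ := by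
        gcongr
        exact (hzB n).le

/-! ### The operator with a given resolvent at `i` -/

/-- The operator `i - R⁻¹` for an injective bounded operator `R`. -/
def ofResolventAtI (R : X →L[ℂ] X) (hR : Function.Injective R) : X →ₗ.[ℂ] X where
  domain := LinearMap.range R.toLinearMap
  toFun := Complex.I • (LinearMap.range R.toLinearMap).subtype -
    (LinearEquiv.ofInjective R.toLinearMap hR).symm.toLinearMap

theorem apply_sub_ofResolventAtI {R : X →L[ℂ] X} (hR : Function.Injective R)
    (x : (ofResolventAtI R hR).domain) :
    R (Complex.I • (x : X) - ofResolventAtI R hR x) = x := by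
  change R (Complex.I • (x : X) - (Complex.I • (x : X) -
    (LinearEquiv.ofInjective R.toLinearMap hR).symm x)) = x
  rw [sub_sub_cancel]
  exact congrArg Subtype.val ((LinearEquiv.ofInjective R.toLinearMap hR).apply_symm_apply x)

/-- The graph is cut out by a continuous equation, which makes closedness immediate. -/
theorem mem_graph_ofResolventAtI {R : X →L[ℂ] X} (hR : Function.Injective R) (p : X × X) :
    p ∈ (ofResolventAtI R hR).graph ↔ R (Complex.I • p.1 - p.2) = p.1 := by
  rw [LinearPMap.mem_graph_iff]
  constructor
  · rintro ⟨x, h1, h2⟩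
    rw [← h1, ← h2]
    exact apply_sub_ofResolventAtI hR x
  · intro h
    let x : (ofResolventAtI R hR).domain := ⟨p.1, _, h⟩
    refine ⟨x, rfl, ?_⟩
    have h1 := hR ((apply_sub_ofResolventAtI hR x).trans h.symm)
    exact sub_right_injective h1

theorem isClosed_ofResolventAtI {R : X →L[ℂ] X} (hR : Function.Injective R) :
    (ofResolventAtI R hR).IsClosed := by
  have : ((ofResolventAtI R hR).graph : Set (X × X)) =
      {p | R (Complex.I • p.1 - p.2) = p.1} := by
    ext p
    exact mem_graph_ofResolventAtI hR p
  rw [LinearPMap.IsClosed, this]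
  exact isClosed_eq (by fun_prop) (by fun_prop)

/-- If `x = R y` then `(z - a) x = y - (i - z) R y`. The identity with `S ∘ R` gives the left
inverse and the one with `R ∘ S` the right inverse. -/
theorem isResolventAt_ofResolventAtI {R : X →L[ℂ] X} (hR : Function.Injective R) {z : ℂ}
    {S : X →L[ℂ] X} (h₁ : S - R = (Complex.I - z) • S.comp R)
    (h₂ : S - R = (Complex.I - z) • R.comp S) : IsResolventAt (ofResolventAtI R hR) z S := by
  constructor
  · intro x
    set y := Complex.I • (x : X) - ofResolventAtI R hR x with hy
    have hx : R y = x := apply_sub_ofResolventAtI hR x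
    have h3 : z • (x : X) - ofResolventAtI R hR x = y - (Complex.I - z) • R y := by
      rw [hx, hy, sub_smul]
      abel
    have h4 : S y - R y = (Complex.I - z) • S (R y) := congrArg (fun U : X →L[ℂ] X => U y) h₁
    rw [h3, map_sub, map_smul, ← h4, sub_sub_cancel, hx]
  · intro y
    have h4 : S y - R y = (Complex.I - z) • R (S y) := congrArg (fun U : X →L[ℂ] X => U y) h₂
    have h5 : R (Complex.I • S y - (z • S y - y)) = S y := by
      rw [show Complex.I • S y - (z • S y - y) = (Complex.I - z) • S y + y by
        rw [sub_smul]; abel, map_add, map_smul, ← h4]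
      abel
    obtain ⟨x, hx1, hx2⟩ := (LinearPMap.mem_graph_iff _).1
      ((mem_graph_ofResolventAtI hR (S y, z • S y - y)).2 h5)
    refine ⟨x, hx1, ?_⟩
    rw [hx1, hx2]
    exact sub_sub_cancel _ _

/-! ### From a calculus on `𝒢(ℝ)` to an operator -/

/-- The test function `t ↦ (z - t) φ(t)`. -/
def TestFn.subMul (φ : TestFn) (z : ℂ) : TestFn :=
  TestFn.of (fun t => (z - t) * φ t)
    ((contDiff_const.sub Complex.ofRealCLM.contDiff).mul φ.smooth) φ.hasCompactSupport.mul_left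

@[simp]
theorem TestFn.subMul_apply (φ : TestFn) (z : ℂ) (t : ℝ) : φ.subMul z t = (z - t) * φ t := rfl

theorem TestFn.divSub_subMul (φ : TestFn) {z : ℂ} (hz : z.im ≠ 0) :
    (φ.subMul z).divSub z = φ := by
  ext t
  rw [TestFn.divSub_apply _ hz, TestFn.subMul_apply]
  have := sub_ofReal_ne_zero hz t
  field_simp

theorem TestFn.subMul_divSub (φ : TestFn) {z : ℂ} (hz : z.im ≠ 0) :
    (φ.divSub z).subMul z = φ := by
  ext t
  rw [TestFn.subMul_apply, TestFn.divSub_apply _ hz]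
  have := sub_ofReal_ne_zero hz t
  field_simp

theorem exists_isHSOperator_of_extension [CompleteSpace X] {A : TestFn →L[ℂ] (X →L[ℂ] X)}
    (hA : IsHyperoperator A) {B : G →ₗ[ℂ] (X →L[ℂ] X)}
    (hmul : ∀ f g : G, B (f * g) = (B f).comp (B g)) (hcont : IsContinuousOnG B)
    (hBA : ∀ φ : TestFn, B φ.toG = A φ) :
    ∃ a : X →ₗ.[ℂ] X, IsHSOperator a ∧ IsHSCalculus a A := by
  let R : ℂ → X →L[ℂ] X := fun z => B (cauchyG z)
  have hRA : ∀ z : ℂ, z.im ≠ 0 → ∀ φ : TestFn, (R z).comp (A φ) = A (φ.divSub z) := by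
    intro z hz φ
    rw [← hBA, ← hBA, ← hmul, cauchyG_mul_toG hz]
  have hAR : ∀ z : ℂ, z.im ≠ 0 → ∀ φ : TestFn, (A φ).comp (R z) = A (φ.divSub z) := by
    intro z hz φ
    rw [← hBA, ← hBA, ← hmul, mul_comm, cauchyG_mul_toG hz]
  have hres : ∀ z w : ℂ, z.im ≠ 0 → w.im ≠ 0 → R w - R z = (z - w) • (R w).comp (R z) := by
    intro z w hz hw
    simp only [R]
    rw [← map_sub, cauchyG_sub hz hw, map_smul, hmul]
  have hI : Complex.I.im ≠ 0 := by simp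
  -- `A φ = A ((i - t) φ) ∘ R i`, so a vector killed by `R i` is killed by every `A φ`. The mirrored
  -- identity `A φ = R i ∘ A ((i - t) φ)` gives the density of the domain below.
  have hinj : Function.Injective (R Complex.I) := by
    refine (injective_iff_map_eq_zero _).2 fun x hx => hA.ker_eq_zero x fun φ => ?_
    have := congrArg (fun U : X →L[ℂ] X => U x) (hAR _ hI (φ.subMul Complex.I))
    rw [TestFn.divSub_subMul φ hI] at this
    rw [← this, ContinuousLinearMap.comp_apply, hx, map_zero]
  let a := ofResolventAtI (R Complex.I) hinj
  have hresolvent : ∀ z : ℂ, z.im ≠ 0 → IsResolventAt a z (R z) := by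
    intro z hz
    refine isResolventAt_ofResolventAtI hinj (hres _ _ hI hz) ?_
    rw [← neg_sub, hres _ _ hz hI, ← neg_smul, neg_sub]
  have hpmap : ∀ z : ℂ, z.im ≠ 0 → pmapResolvent a z = R z := fun z hz =>
    (isResolventAt_pmapResolvent ⟨R z, hresolvent z hz⟩).unique (hresolvent z hz)
  have hbound : ∀ K : Set ℂ, IsCompact K → ∃ (N : ℕ) (C : ℝ),
      ∀ z ∈ K, z.im ≠ 0 → ‖pmapResolvent a z‖ ≤ C * (1 / |z.im|) ^ N := by
    intro K hK
    obtain ⟨N, C, h⟩ := exists_bound_cauchyG B hcont hK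
    exact ⟨N, C, fun z hzK hz => by rw [hpmap z hz]; exact h z hzK hz⟩
  have ha : IsHSOperator a := by
    refine ⟨?_, isClosed_ofResolventAtI hinj, fun z hz => ?_, hbound⟩
    · refine hA.dense_range.mono ?_
      rintro y hy
      obtain ⟨φ, x, rfl⟩ := Set.mem_iUnion.1 hy
      have := congrArg (fun U : X →L[ℂ] X => U x) (hRA _ hI (φ.subMul Complex.I))
      rw [TestFn.divSub_subMul φ hI] at this
      exact ⟨_, this⟩
    · by_contra h
      exact hz ⟨R z, hresolvent z h⟩
  refine ⟨a, ha, fun φ F hF => ⟨ha.integrable_smul hF.isFlat, hA.ext fun ψ => ?_⟩⟩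
  rw [cauchyIntegral_comp A (R := pmapResolvent a)
    (fun z hz ψ => by rw [hpmap z hz, hRA z hz]) (hF.contDiff.of_le (by simp)) hF.isFlat
    hF.hasCompactSupport.is_zero_at_infty (ha.integrable_smul hF.isFlat) ψ (φ.mul ψ) fun t => by
      rw [TestFn.mul_apply, hF.extends_fn, sub_zero, mul_comm]]
  exact (hA.map_mul φ ψ).symm

/-! ### From an operator to a calculus on `𝒢(ℝ)` -/

/-- The factor `z - w` is holomorphic in `w`, so `∂̄` passes through it, and its growth is harmless
on the compact support of `∂̄F`. -/
theorem IsAlmostHolExtension.subMul {φ : TestFn} {F : ℂ → ℂ} (hF : IsAlmostHolExtension φ F)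
    (z : ℂ) : IsAlmostHolExtension (φ.subMul z) (fun w => (z - w) * F w) ∧
      ∀ w, dbar (fun w => (z - w) * F w) w = (z - w) * dbar F w := by
  have hd : ∀ w, dbar (fun w => (z - w) * F w) w = (z - w) * dbar F w := fun w => by
    have h : DifferentiableAt ℂ (fun w => z - w) w := by fun_prop
    have h1 := dbar_mul (h.restrictScalars ℝ) (hF.contDiff.differentiable (by simp) w)
    linear_combination h1 + F w * dbar_eq_zero_of_differentiableAt h
  refine ⟨⟨(contDiff_const.sub contDiff_id).mul hF.contDiff, hF.hasCompactSupport.mul_left,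
    fun x => ?_, fun N => ?_⟩, hd⟩
  · rw [hF.extends_fn, TestFn.subMul_apply]
  · obtain ⟨C, hC⟩ := hF.dbar_bound N
    obtain ⟨M, hM⟩ := hF.isFlat.hasCompactSupport.isCompact.isBounded.exists_norm_le
    refine ⟨(‖z‖ + |M|) * C, fun w => ?_⟩
    rw [hd, norm_mul]
    have h0 : 0 ≤ C * |w.im| ^ N := (norm_nonneg _).trans (hC w)
    by_cases hw : w ∈ tsupport (dbar F)
    · calc ‖z - w‖ * ‖dbar F w‖ ≤ (‖z‖ + |M|) * (C * |w.im| ^ N) := by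
            gcongr
            · exact (norm_sub_le _ _).trans
                (add_le_add le_rfl ((hM w hw).trans (le_abs_self M)))
            · exact hC w
        _ = _ := by ring
    · rw [image_eq_zero_of_notMem_tsupport hw, norm_zero, mul_zero, mul_assoc]
      positivity

/-- If `F` extends `φ / (z - ·)`, then `(z - w) F(w)` extends `φ`. The resolvent identity replaces
`(z - w) (z - a)⁻¹ (w - a)⁻¹` by `(w - a)⁻¹ - (z - a)⁻¹`, and the second term drops out because `∫
∂̄F = 0`. -/
theorem IsHSCalculus.resolvent_comp [CompleteSpace X] {A : TestFn →L[ℂ] (X →L[ℂ] X)}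
    {a : X →ₗ.[ℂ] X} (ha : IsHSOperator a) (hcal : IsHSCalculus a A) {z : ℂ} (hz : z.im ≠ 0)
    (φ : TestFn) : (pmapResolvent a z).comp (A φ) = A (φ.divSub z) := by
  obtain ⟨F, hF, -⟩ := exists_isAlmostHolExtension (φ.divSub z)
  obtain ⟨h1, h2⟩ := hcal _ F hF
  obtain ⟨hFz, hd⟩ := hF.subMul z
  obtain ⟨h3, h4⟩ := hcal _ _ hFz
  rw [TestFn.subMul_divSub φ hz] at h4
  let L : (X →L[ℂ] X) →L[ℂ] (X →L[ℂ] X) := ContinuousLinearMap.compL ℂ X X X (pmapResolvent a z)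
  have hL : ∀ S, L S = (pmapResolvent a z).comp S := fun S => rfl
  have hint0 : Integrable (dbar F) :=
    hF.isFlat.continuous.integrable_of_hasCompactSupport hF.isFlat.hasCompactSupport
  have hae : (fun w => L (dbar (fun w => (z - w) * F w) w • pmapResolvent a w)) =ᵐ[volume]
      fun w => dbar F w • pmapResolvent a w - dbar F w • pmapResolvent a z := by
    filter_upwards [ae_im_ne_zero] with w hw
    rw [map_smul, hL, hd, mul_comm, mul_smul,
      ← (ha.isResolventAt hz).sub_eq (ha.isResolventAt hw), smul_sub]
  rw [← hL, h4, map_smul, ← L.integral_comp_comm h3, integral_congr_ae hae,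
    integral_sub h1 (hint0.smul_const _), integral_smul_const,
    integral_dbar_eq_zero (hF.contDiff.of_le (by simp)) hF.hasCompactSupport, zero_smul, sub_zero,
    h2]

/-- The product of a test function and an element of `𝒢(ℝ)`. -/
def TestFn.gMul (φ : TestFn) (f : G) : TestFn :=
  TestFn.of (fun t => (f : OnePoint ℝ → ℂ) (t : OnePoint ℝ) * φ t) (f.2.1.mul φ.smooth)
    φ.hasCompactSupport.mul_left

@[simp]
theorem TestFn.gMul_apply (φ : TestFn) (f : G) (t : ℝ) :
    φ.gMul f t = (f : OnePoint ℝ → ℂ) (t : OnePoint ℝ) * φ t := rfl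

/-- For `f ∈ 𝒢(ℝ)` and an almost holomorphic cutoff function `Θ` which is `1` where the extension
`g (1 / z)` of `f` is not holomorphic, the function `(1 - Θ z) * g (1 / z)` on the plane. -/
def outer (Θ g : ℂ → ℂ) (z : ℂ) : ℂ := (1 - Θ z) * g z⁻¹

section outer

variable {f : G} {r : ℝ} {g : ℂ → ℂ} {θ : TestFn} {Θ : ℂ → ℂ}

theorem inv_mem_ball (hr : 0 < r) {z : ℂ} (hz : 1 / r < ‖z‖) : z⁻¹ ∈ Metric.ball (0 : ℂ) r := by
  rw [mem_ball_zero_iff, norm_inv]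
  rw [one_div] at hz
  exact inv_lt_of_inv_lt₀ hr hz

theorem eventuallyEq_one (hΘ1 : ∀ z, ‖z‖ ≤ 2 / r → Θ z = 1) {z : ℂ} (hz : ‖z‖ < 2 / r) :
    Θ =ᶠ[𝓝 z] fun _ => 1 := by
  filter_upwards [(continuous_norm.tendsto z).eventually (gt_mem_nhds hz)] with w hw
  exact hΘ1 w hw.le

theorem dbar_eq_zero_of_norm_lt (hΘ1 : ∀ z, ‖z‖ ≤ 2 / r → Θ z = 1) {z : ℂ} (hz : ‖z‖ < 2 / r) :
    dbar Θ z = 0 := by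
  rw [dbar_congr (eventuallyEq_one hΘ1 hz),
    dbar_eq_zero_of_differentiableAt (differentiableAt_const _)]

theorem outer_eventuallyEq_zero (hΘ1 : ∀ z, ‖z‖ ≤ 2 / r → Θ z = 1) {z : ℂ} (hz : ‖z‖ < 2 / r) :
    outer Θ g =ᶠ[𝓝 z] fun _ => 0 := by
  filter_upwards [eventuallyEq_one hΘ1 hz] with w hw
  rw [outer, hw, sub_self, zero_mul]

theorem differentiableAt_comp_inv (hr : 0 < r) (hg : DifferentiableOn ℂ g (Metric.ball 0 r))
    {z : ℂ} (hz : 1 / r < ‖z‖) : DifferentiableAt ℂ (fun z => g z⁻¹) z := by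
  have hz0 : z ≠ 0 := norm_pos_iff.1 ((by positivity : 0 < 1 / r).trans hz)
  exact (hg.differentiableAt (Metric.isOpen_ball.mem_nhds (inv_mem_ball hr hz))).comp z
    (differentiableAt_inv hz0)

/-- The function vanishes for `‖z‖ < 2 / r`, so the convention `0⁻¹ = 0` does no harm, while
`g(1/z)` is holomorphic already for `‖z‖ > 1 / r`. The gap between the radii also keeps `1 / z` in
the compact disc of radius `r / 2` wherever `Θ` may differ from `1`. -/
theorem contDiff_outer (hr : 0 < r) (hg : DifferentiableOn ℂ g (Metric.ball 0 r))
    (hΘ : IsAlmostHolExtension θ Θ) (hΘ1 : ∀ z, ‖z‖ ≤ 2 / r → Θ z = 1) :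
    ContDiff ℝ 1 (outer Θ g) := by
  refine contDiff_iff_contDiffAt.2 fun z => ?_
  rcases lt_or_ge ‖z‖ (2 / r) with hz | hz
  · exact contDiffAt_const.congr_of_eventuallyEq (outer_eventuallyEq_zero hΘ1 hz)
  · have hz' : 1 / r < ‖z‖ := lt_of_lt_of_le (by gcongr; norm_num) hz
    have hz0 : z ≠ 0 := norm_pos_iff.1 ((by positivity : 0 < 1 / r).trans hz')
    have h1 : ContDiffAt ℂ 1 g z⁻¹ :=
      (hg.contDiffOn Metric.isOpen_ball).contDiffAt
        (Metric.isOpen_ball.mem_nhds (inv_mem_ball hr hz'))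
    have h2 : ContDiffAt ℂ 1 (fun z => g z⁻¹) z := h1.comp z (contDiffAt_inv ℂ hz0)
    exact (contDiff_const.sub (hΘ.contDiff.of_le (by simp))).contDiffAt.mul
      (h2.restrict_scalars ℝ)

theorem dbar_outer (hr : 0 < r) (hg : DifferentiableOn ℂ g (Metric.ball 0 r))
    (hΘ : IsAlmostHolExtension θ Θ) (hΘ1 : ∀ z, ‖z‖ ≤ 2 / r → Θ z = 1) (z : ℂ) :
    dbar (outer Θ g) z = -(dbar Θ z * g z⁻¹) := by
  rcases lt_or_ge ‖z‖ (2 / r) with hz | hz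
  · rw [dbar_congr (outer_eventuallyEq_zero hΘ1 hz), dbar_eq_zero_of_norm_lt hΘ1 hz,
      dbar_eq_zero_of_differentiableAt (differentiableAt_const _), zero_mul, neg_zero]
  · have hz' : 1 / r < ‖z‖ := lt_of_lt_of_le (by gcongr; norm_num) hz
    have h1 := differentiableAt_comp_inv hr hg hz'
    have h2 : DifferentiableAt ℝ (fun z => 1 - Θ z) z :=
      (hΘ.contDiff.differentiable (by simp) z).const_sub 1
    unfold outer
    rw [dbar_mul h2 (h1.restrictScalars ℝ), dbar_eq_zero_of_differentiableAt h1, dbar_const_sub,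
      mul_zero, zero_add, neg_mul]

theorem inv_mem_closedBall (hr : 0 < r) {z : ℂ} (hz : 2 / r ≤ ‖z‖) :
    z⁻¹ ∈ Metric.closedBall (0 : ℂ) (r / 2) := by
  rw [mem_closedBall_zero_iff, norm_inv, ← inv_div]
  exact inv_anti₀ (by positivity) hz

theorem closedBall_half_subset (hr : 0 < r) :
    Metric.closedBall (0 : ℂ) (r / 2) ⊆ Metric.ball 0 r :=
  Metric.closedBall_subset_ball (half_lt_self hr)

theorem isFlat_dbar_outer (hr : 0 < r) (hg : DifferentiableOn ℂ g (Metric.ball 0 r))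
    (hΘ : IsAlmostHolExtension θ Θ) (hΘ1 : ∀ z, ‖z‖ ≤ 2 / r → Θ z = 1) :
    IsFlat (dbar (outer Θ g)) := by
  refine ⟨continuous_dbar (contDiff_outer hr hg hΘ hΘ1), ?_, fun N => ?_⟩
  · rw [funext (dbar_outer hr hg hΘ hΘ1)]
    exact (hΘ.isFlat.hasCompactSupport.mul_right).neg
  · obtain ⟨C, hC⟩ := hΘ.dbar_bound N
    obtain ⟨M, hM⟩ := (isCompact_closedBall (0 : ℂ) (r / 2)).exists_bound_of_continuousOn
      (hg.continuousOn.mono (closedBall_half_subset hr))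
    refine ⟨C * |M|, fun z => ?_⟩
    have h0 : 0 ≤ C * |z.im| ^ N := (norm_nonneg _).trans (hC z)
    rw [dbar_outer hr hg hΘ hΘ1, norm_neg, norm_mul]
    rcases lt_or_ge ‖z‖ (2 / r) with hz | hz
    · rw [dbar_eq_zero_of_norm_lt hΘ1 hz, norm_zero, zero_mul, mul_right_comm]
      positivity
    · calc ‖dbar Θ z‖ * ‖g z⁻¹‖ ≤ (C * |z.im| ^ N) * |M| :=
            mul_le_mul (hC z) ((hM _ (inv_mem_closedBall hr hz)).trans (le_abs_self M))
              (norm_nonneg _) h0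
        _ = _ := by ring

theorem tendsto_outer (hr : 0 < r) (hg : DifferentiableOn ℂ g (Metric.ball 0 r))
    (hΘ : IsAlmostHolExtension θ Θ) : Tendsto (outer Θ g) (cocompact ℂ) (𝓝 (g 0)) := by
  have h1 : Tendsto (fun z : ℂ => g z⁻¹) (cocompact ℂ) (𝓝 (g 0)) := by
    rw [← Metric.cobounded_eq_cocompact]
    exact ((hg.continuousOn.continuousAt (Metric.ball_mem_nhds 0 hr)).tendsto).comp
      tendsto_inv₀_cobounded
  have h2 : Tendsto Θ (cocompact ℂ) (𝓝 0) := hΘ.hasCompactSupport.is_zero_at_infty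
  have h3 := (h2.const_sub 1).mul h1
  rwa [sub_zero, one_mul] at h3

theorem outer_ofReal (hr : 0 < r) (hg : IsHolNearInfty (f : OnePoint ℝ → ℂ) r g)
    (hΘ : IsAlmostHolExtension θ Θ) (hΘ1 : ∀ z, ‖z‖ ≤ 2 / r → Θ z = 1) (t : ℝ) :
    outer Θ g t = (1 - θ t) * (f : OnePoint ℝ → ℂ) (t : OnePoint ℝ) := by
  rw [outer]
  rcases le_or_gt ‖(t : ℂ)‖ (2 / r) with ht | ht
  · rw [← hΘ.extends_fn, hΘ1 _ ht, sub_self, zero_mul, zero_mul]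
  · have ht' : 1 / r < ‖(t : ℂ)‖ := lt_trans (by gcongr; norm_num) ht
    have ht0 : t ≠ 0 := by
      have : (t : ℂ) ≠ 0 := norm_pos_iff.1 ((by positivity : 0 < 1 / r).trans ht')
      exact_mod_cast this
    have h1 := inv_mem_ball hr ht'
    rw [mem_ball_zero_iff, ← Complex.ofReal_inv, Complex.norm_real, Real.norm_eq_abs] at h1
    have h2 := hg.at_inv t⁻¹ (inv_ne_zero ht0) h1
    rw [inv_inv] at h2
    rw [hΘ.extends_fn, ← Complex.ofReal_inv, h2]

end outer

/-- The value of the functional calculus on `f ∈ 𝒢(ℝ)`, computed with the help of a cutoff function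
`θ`, its almost holomorphic extension `Θ` and the holomorphic extension `g` of `f` near infinity. -/
def calculusG (A : TestFn →L[ℂ] (X →L[ℂ] X)) (a : X →ₗ.[ℂ] X) (θ : TestFn) (Θ : ℂ → ℂ) (f : G)
    (g : ℂ → ℂ) : X →L[ℂ] X :=
  A (θ.gMul f) + g 0 • ContinuousLinearMap.id ℂ X +
    (-(1 / Real.pi : ℂ)) • ∫ z : ℂ, dbar (outer Θ g) z • pmapResolvent a z

/-- The three summands of `calculusG` match the splitting `f φ = θ f φ + f(∞) φ + ((1 - θ) f - f(∞))
φ`; the last part is the Cauchy integral with `c = g 0 = f(∞)`. -/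
theorem calculusG_comp [CompleteSpace X] {A : TestFn →L[ℂ] (X →L[ℂ] X)} (hA : IsHyperoperator A)
    {a : X →ₗ.[ℂ] X} (ha : IsHSOperator a) (hcal : IsHSCalculus a A) {f : G} {r : ℝ} {g : ℂ → ℂ}
    {θ : TestFn} {Θ : ℂ → ℂ} (hr : 0 < r) (hg : IsHolNearInfty (f : OnePoint ℝ → ℂ) r g)
    (hΘ : IsAlmostHolExtension θ Θ) (hΘ1 : ∀ z, ‖z‖ ≤ 2 / r → Θ z = 1) (φ : TestFn) :
    (calculusG A a θ Θ f g).comp (A φ) = A (φ.gMul f) := by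
  have hflat := isFlat_dbar_outer hr hg.1 hΘ hΘ1
  have h := cauchyIntegral_comp A (R := pmapResolvent a)
    (fun z hz φ => hcal.resolvent_comp ha hz φ) (contDiff_outer hr hg.1 hΘ hΘ1) hflat
    (tendsto_outer hr hg.1 hΘ) (ha.integrable_smul hflat) φ
    (φ.gMul f - (θ.gMul f).mul φ - g 0 • φ) fun t => by
      rw [sub_apply, sub_apply, smul_apply, TestFn.mul_apply, TestFn.gMul_apply,
        TestFn.gMul_apply, outer_ofReal hr hg hΘ hΘ1, smul_eq_mul]
      ring
  rw [calculusG, ContinuousLinearMap.add_comp, ContinuousLinearMap.add_comp, h, map_sub, map_sub,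
    hA.map_mul, map_smul, ContinuousLinearMap.smul_comp, ContinuousLinearMap.id_comp]
  abel

theorem exists_calculusG [CompleteSpace X] {A : TestFn →L[ℂ] (X →L[ℂ] X)} (hA : IsHyperoperator A)
    {a : X →ₗ.[ℂ] X} (ha : IsHSOperator a) (hcal : IsHSCalculus a A) (f : G) :
    ∃ T : X →L[ℂ] X, ∀ φ, T.comp (A φ) = A (φ.gMul f) := by
  obtain ⟨r, hr, g, hg⟩ := f.2.2
  obtain ⟨θ, Θ, hΘ, hΘ1⟩ := exists_isAlmostHolExtension_cutoff (by positivity : 0 < 2 / r)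
  exact ⟨_, calculusG_comp hA ha hcal hr hg hΘ hΘ1⟩

/-- Only finitely many derivatives on the compact support of `θ` matter; the Leibniz rule bounds
those of `θ (u j - f)` by `E` times those of `u j - f`. -/
theorem tendsto_map_gMul {W : Type*} [NormedAddCommGroup W] [NormedSpace ℂ W]
    (A : TestFn →L[ℂ] W) (θ : TestFn) {u : ℕ → G} {f : G}
    (h : ∀ k : ℕ, TendstoLocallyUniformly
      (fun j => iteratedDeriv k (fun x : ℝ => (u j : OnePoint ℝ → ℂ) (x : OnePoint ℝ)))
      (iteratedDeriv k (fun x : ℝ => (f : OnePoint ℝ → ℂ) (x : OnePoint ℝ))) atTop) :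
    Tendsto (fun j => A (θ.gMul (u j))) atTop (𝓝 (A (θ.gMul f))) := by
  have hK : IsCompact (tsupport θ) := θ.hasCompactSupport
  obtain ⟨N, C, hC, hA⟩ := exists_bound_iteratedDeriv A hK
  choose D hD using fun k => (θ.iteratedDeriv_continuous k).bounded_above_of_compact_support
    (hasCompactSupport_iteratedDeriv θ.hasCompactSupport k)
  have hD0 : ∀ k, 0 ≤ D k := fun k => (norm_nonneg _).trans (hD k 0)
  let E : ℝ := ∑ i ∈ Finset.range (N + 1), ∑ l ∈ Finset.range (i + 1), i.choose l * D (i - l)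
  have hE0 : 0 ≤ E := Finset.sum_nonneg fun i _ => Finset.sum_nonneg fun l _ =>
    mul_nonneg (Nat.cast_nonneg _) (hD0 _)
  rw [Metric.tendsto_atTop']
  intro ε hε
  set δ : ℝ := ε / (C * E + 1) with hδ
  have hδ0 : 0 < δ := by positivity
  have hev : ∀ᶠ j in atTop, ∀ k ∈ Finset.range (N + 1), ∀ t ∈ tsupport θ,
      dist (iteratedDeriv k (fun x : ℝ => (f : OnePoint ℝ → ℂ) (x : OnePoint ℝ)) t)
        (iteratedDeriv k (fun x : ℝ => (u j : OnePoint ℝ → ℂ) (x : OnePoint ℝ)) t) < δ := by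
    refine (Filter.eventually_all_finset _).2 fun k _ => ?_
    have h1 := (tendstoLocallyUniformlyOn_iff_tendstoUniformlyOn_of_compact hK).1
      ((h k).tendstoLocallyUniformlyOn (s := tsupport θ))
    exact Metric.tendstoUniformlyOn_iff.1 h1 δ hδ0
  obtain ⟨J, hJ⟩ := eventually_atTop.1 hev
  refine ⟨J, fun j hj => ?_⟩
  have hjδ := hJ j hj.le
  set v : ℝ → ℂ := fun x => (u j : OnePoint ℝ → ℂ) (x : OnePoint ℝ) -
    (f : OnePoint ℝ → ℂ) (x : OnePoint ℝ) with hv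
  have hvs : ContDiff ℝ ∞ v := (u j).2.1.sub f.2.1
  have hcoe : ((θ.gMul (u j) - θ.gMul f : TestFn) : ℝ → ℂ) = fun t => v t * θ t := by
    ext t
    rw [sub_apply, TestFn.gMul_apply, TestFn.gMul_apply, hv]
    ring
  have hvδ : ∀ k ≤ N, ∀ t ∈ tsupport θ, ‖iteratedDeriv k v t‖ ≤ δ := by
    intro k hk t ht
    have h1 := hjδ k (Finset.mem_range.2 (Nat.lt_succ_of_le hk)) t ht
    rw [dist_comm, dist_eq_norm] at h1
    rw [hv, iteratedDeriv_fun_sub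
      ((u j).2.1.of_le (by exact_mod_cast le_top)).contDiffAt
      (f.2.1.of_le (by exact_mod_cast le_top)).contDiffAt]
    exact h1.le
  have hb := hA (θ.gMul (u j) - θ.gMul f) (fun t ht => by
    rw [hcoe]
    simp [image_eq_zero_of_notMem_tsupport ht]) (E * δ) fun i hi t => by
      rw [hcoe, ← norm_iteratedFDeriv_eq_norm_iteratedDeriv]
      refine (norm_iteratedFDeriv_mul_le hvs θ.smooth t
        (by exact_mod_cast le_top : ((i : ℕ∞) : WithTop ℕ∞) ≤ ∞)).trans ?_
      have h2 : ∑ l ∈ Finset.range (i + 1), (i.choose l : ℝ) * ‖iteratedFDeriv ℝ l v t‖ *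
          ‖iteratedFDeriv ℝ (i - l) θ t‖ ≤
          (∑ l ∈ Finset.range (i + 1), (i.choose l : ℝ) * D (i - l)) * δ := by
        rw [Finset.sum_mul]
        refine Finset.sum_le_sum fun l hl => ?_
        rw [norm_iteratedFDeriv_eq_norm_iteratedDeriv, norm_iteratedFDeriv_eq_norm_iteratedDeriv]
        by_cases ht : t ∈ tsupport θ
        · have h3 := hvδ l ((Nat.lt_succ_iff.1 (Finset.mem_range.1 hl)).trans hi) t ht
          calc (i.choose l : ℝ) * ‖iteratedDeriv l v t‖ * ‖iteratedDeriv (i - l) θ t‖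
              ≤ (i.choose l : ℝ) * δ * D (i - l) := by
                gcongr
                exact hD (i - l) t
            _ = _ := by ring
        · rw [iteratedDeriv_eq_zero_of_notMem_tsupport ht, norm_zero, mul_zero]
          have := hD0 (i - l)
          positivity
      refine h2.trans (mul_le_mul_of_nonneg_right ?_ hδ0.le)
      exact Finset.single_le_sum (f := fun i => ∑ l ∈ Finset.range (i + 1),
        (i.choose l : ℝ) * D (i - l)) (fun i _ => Finset.sum_nonneg fun l _ =>
          mul_nonneg (Nat.cast_nonneg _) (hD0 _)) (Finset.mem_range.2 (Nat.lt_succ_of_le hi))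
  rw [dist_eq_norm, ← map_sub]
  refine hb.trans_lt ?_
  have h4 : (C * E + 1) * δ = ε := by
    rw [hδ]
    field_simp
  nlinarith

/-- The integrand is `-g(1/z)` times the fixed integrable function `∂̄Θ(z) (z - a)⁻¹`, which
vanishes for `‖z‖ < 2 / r`. Elsewhere `1 / z` stays in a compact disc on which `gs j → g` uniformly.
-/
theorem tendsto_integral_outer {a : X →ₗ.[ℂ] X} (ha : IsHSOperator a) {r : ℝ} (hr : 0 < r)
    {θ : TestFn} {Θ : ℂ → ℂ} (hΘ : IsAlmostHolExtension θ Θ)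
    (hΘ1 : ∀ z, ‖z‖ ≤ 2 / r → Θ z = 1) {gs : ℕ → ℂ → ℂ} {g : ℂ → ℂ}
    (hgs : ∀ j, DifferentiableOn ℂ (gs j) (Metric.ball 0 r))
    (hg : DifferentiableOn ℂ g (Metric.ball 0 r))
    (hlim : TendstoLocallyUniformlyOn gs g atTop (Metric.ball 0 r)) :
    Tendsto (fun j => ∫ z : ℂ, dbar (outer Θ (gs j)) z • pmapResolvent a z) atTop
      (𝓝 (∫ z : ℂ, dbar (outer Θ g) z • pmapResolvent a z)) := by
  set I : ℝ := ∫ z : ℂ, ‖dbar Θ z • pmapResolvent a z‖ with hI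
  have hI0 : 0 ≤ I := integral_nonneg fun _ => norm_nonneg _
  have hint := ha.integrable_smul hΘ.isFlat
  have hunif := (tendstoLocallyUniformlyOn_iff_tendstoUniformlyOn_of_compact
    (isCompact_closedBall (0 : ℂ) (r / 2))).1 (hlim.mono (closedBall_half_subset hr))
  rw [Metric.tendsto_nhds]
  intro ε hε
  set δ : ℝ := ε / (I + 1) with hδ
  have hδ0 : 0 < δ := by positivity
  filter_upwards [Metric.tendstoUniformlyOn_iff.1 hunif δ hδ0] with j hj
  rw [dist_eq_norm, ← integral_sub
    (ha.integrable_smul (isFlat_dbar_outer hr (hgs j) hΘ hΘ1))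
    (ha.integrable_smul (isFlat_dbar_outer hr hg hΘ hΘ1))]
  have hle : ‖∫ z : ℂ, (dbar (outer Θ (gs j)) z • pmapResolvent a z -
      dbar (outer Θ g) z • pmapResolvent a z)‖ ≤
      ∫ z : ℂ, δ * ‖dbar Θ z • pmapResolvent a z‖ := by
    refine norm_integral_le_of_norm_le (hint.norm.const_mul δ) (Eventually.of_forall fun z => ?_)
    rw [← sub_smul, dbar_outer hr (hgs j) hΘ hΘ1, dbar_outer hr hg hΘ hΘ1,
      show -(dbar Θ z * gs j z⁻¹) - -(dbar Θ z * g z⁻¹) = (g z⁻¹ - gs j z⁻¹) * dbar Θ z by ring,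
      mul_smul, norm_smul]
    rcases lt_or_ge ‖z‖ (2 / r) with hz | hz
    · rw [dbar_eq_zero_of_norm_lt hΘ1 hz, zero_smul, norm_zero, mul_zero, mul_zero]
    · have h1 := hj _ (inv_mem_closedBall hr hz)
      rw [dist_eq_norm] at h1
      gcongr
  refine hle.trans_lt ?_
  rw [integral_const_mul, ← hI]
  have h4 : (I + 1) * δ = ε := by
    rw [hδ]
    field_simp
  linarith

theorem exists_extension_of_isHSCalculus [CompleteSpace X] {A : TestFn →L[ℂ] (X →L[ℂ] X)}
    (hA : IsHyperoperator A) {a : X →ₗ.[ℂ] X} (ha : IsHSOperator a) (hcal : IsHSCalculus a A) :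
    ∃ B : G →ₗ[ℂ] (X →L[ℂ] X), (∀ f g : G, B (f * g) = (B f).comp (B g)) ∧
      IsContinuousOnG B ∧ ∀ φ : TestFn, B φ.toG = A φ := by
  -- `T f` is characterized by `T f ∘ A φ = A (f φ)`, so the cutoffs and extensions chosen
  -- separately for each `f` leave no trace.
  choose T hT using exists_calculusG hA ha hcal
  have huniq : ∀ {f : G} {S : X →L[ℂ] X}, (∀ φ, S.comp (A φ) = A (φ.gMul f)) → T f = S :=
    fun {f S} hS => hA.ext fun φ => by rw [hT, hS]
  let B : G →ₗ[ℂ] (X →L[ℂ] X) :=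
    { toFun := T
      map_add' := fun f g => huniq fun φ => by
        rw [ContinuousLinearMap.add_comp, hT, hT, ← map_add]
        congr 1
        ext t
        simp [add_mul]
      map_smul' := fun c f => huniq fun φ => by
        rw [RingHom.id_apply, ContinuousLinearMap.smul_comp, hT, ← map_smul]
        congr 1
        ext t
        simp [mul_assoc] }
  refine ⟨B, fun f g => huniq fun φ => ?_, fun u f hu => ?_, fun φ => huniq fun ψ => ?_⟩
  · change ((T f).comp (T g)).comp (A φ) = _
    rw [ContinuousLinearMap.comp_assoc, hT, hT]
    congr 1
    ext t
    simp [mul_assoc]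
  · obtain ⟨hu1, r, hr, gs, g, hgs, hg, hlim⟩ := hu
    obtain ⟨θ, Θ, hΘ, hΘ1⟩ := exists_isAlmostHolExtension_cutoff (by positivity : 0 < 2 / r)
    -- By uniqueness all `B (u j)` and `B f` can be recomputed with one radius and one cutoff, after
    -- which each summand of `calculusG` converges.
    have hBu : ∀ j, B (u j) = calculusG A a θ Θ (u j) (gs j) := fun j =>
      huniq (calculusG_comp hA ha hcal hr (hgs j) hΘ hΘ1)
    have hBf : B f = calculusG A a θ Θ f g := huniq (calculusG_comp hA ha hcal hr hg hΘ hΘ1)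
    rw [funext hBu, hBf]
    have h0 : Tendsto (fun j => gs j 0) atTop (𝓝 (g 0)) :=
      hlim.tendsto_at (Metric.mem_ball_self hr)
    exact ((tendsto_map_gMul A θ hu1).add (h0.smul_const _)).add
      ((tendsto_integral_outer ha hr hΘ hΘ1 (fun j => (hgs j).1) hg.1 hlim).const_smul _)
  · rw [← hA.map_mul]
    rfl

end SmoothCalculus

end

theorem theorem6p3 {X : Type*} [NormedAddCommGroup X] [NormedSpace ℂ X] [CompleteSpace X]
    (A : SmoothCalculus.TestFn →L[ℂ] (X →L[ℂ] X)) (hA : SmoothCalculus.IsHyperoperator A) :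
    (∃ a : X →ₗ.[ℂ] X, SmoothCalculus.IsHSOperator a ∧ SmoothCalculus.IsHSCalculus a A) ↔
      ∃ B : SmoothCalculus.G →ₗ[ℂ] (X →L[ℂ] X),
        (∀ f g : SmoothCalculus.G, B (f * g) = (B f).comp (B g)) ∧
        SmoothCalculus.IsContinuousOnG B ∧
        ∀ φ : SmoothCalculus.TestFn, B φ.toG = A φ := by
  constructor
  · rintro ⟨a, ha, hcal⟩
    exact SmoothCalculus.exists_extension_of_isHSCalculus hA ha hcal
  · rintro ⟨B, hmul, hcont, hBA⟩
    exact SmoothCalculus.exists_isHSOperator_of_extension hA hmul hcont hBA
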